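/- Let $(\Omega,\mathcal F,\mathbb P)$ be a probability space carrying two independent standard Brownian motions $B_1=(B_{1,t})_{t\in[0,1]}$ and $B_3=(B_{3,t})_{t\in[0,1]}$, let $\sigma_1,\sigma_2>0$ and $\rho\in(-1,1)$ be constants, and put $B_{2,t}=\rho B_{1,t}+\sqrt{1-\rho^2}\,B_{3,t}$. For $\ell=1,2$ let $b_\ell\in L^\infty([0,1]\times\Omega,\,dt\otimes\mathbb P)$ and let $X_\ell=(X_{\ell,t})_{t\in[0,1]}$ satisfy $$dX_{\ell,t}=\sigma_\ell\,dB_{\ell,t}+b_\ell(t,\omega)\,dt .$$ For $n\ge 1$ write $\Delta_k^nX_\ell=X_{\ell,k/n}-X_{\ell,(k-1)/n}$ and consider the realized correlation $$\varrho_1^n(X)=\frac{\sum_{k=1}^n\Delta_k^nX_1\,\Delta_k^nX_2}{\sqrt{\sum_{k=1}^n(\Delta_k^nX_1)^2\;\sum_{k=1}^n(\Delta_k^nX_2)^2}}$$ (with value $0$, say, if the denominator vanishes). Then $(\varrho_1^n(X))_{n\ge1}$ satisfies the large deviation principle on $\mathbb R$ with speed $n$ and with the good rate function $$I^\rho_{ldp}(u)=\begin{cases}\log\left(\dfrac{1-\rho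 u}{\sqrt{1-\rho^2}\,\sqrt{1-u^2}}\right), & -1<u<1,\\[2mm] +\infty, & \text{otherwise.}\end{cases}$$ That is, $I^\rho_{ldp}:\mathbb R\to[0,+\infty]$ has compact sub-level sets, and for every Borel set $A\subset\mathbb R$ $$-\inf_{u\in A^{o}} I^\rho_{ldp}(u)\le\liminf_{n\to\infty}\frac1n\log\mathbb P(\varrho_1^n(X)\in A)\le\limsup_{n\to\infty}\frac1n\log\mathbb P(\varrho_1^n(X)\in A)\le-\inf_{u\in\bar A} I^\rho_{ldp}(u).$$ -/

import Mathlib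

open MeasureTheory ProbabilityTheory Filter Topology
open scoped ENNReal

/-! ### Large deviation principle -/

/-- A rate function on `S`: it takes values in `[0, +∞]` and is lower semicontinuous, that is,
its sub-level sets are closed. -/
structure IsRateFunction {S : Type*} [TopologicalSpace S] (I : S → EReal) : Prop where
  nonneg : ∀ x, 0 ≤ I x
  isClosed_le : ∀ c : ℝ, 0 ≤ c → IsClosed {x | I x ≤ (c : EReal)}

/-- A good rate function: a rate function whose sub-level sets are compact. -/
structure IsGoodRateFunction {S : Type*} [TopologicalSpace S] (I : S → EReal) : Prop
    extends IsRateFunction I where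
  isCompact_le : ∀ c : ℝ, 0 ≤ c → IsCompact {x | I x ≤ (c : EReal)}

/-- The sequence `M` of `S`-valued random variables satisfies the large deviation principle with
speed `speed` and rate function `I`. Here `ENNReal.log 0 = -∞`, and an infimum over the empty set
is `+∞`. -/
structure SatisfiesLDP {Ω S : Type*} [MeasurableSpace Ω] [TopologicalSpace S] [MeasurableSpace S]
    (P : Measure Ω) (M : ℕ → Ω → S) (speed : ℕ → ℝ) (I : S → EReal) : Prop where
  speed_tendsto : Tendsto speed atTop atTop
  rate : IsRateFunction I
  lower : ∀ A : Set S, MeasurableSet A →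
    -(⨅ x ∈ interior A, I x) ≤
      liminf (fun n => ENNReal.log (P {ω | M n ω ∈ A}) / (speed n : EReal)) atTop
  upper : ∀ A : Set S, MeasurableSet A →
    limsup (fun n => ENNReal.log (P {ω | M n ω ∈ A}) / (speed n : EReal)) atTop ≤
      -(⨅ x ∈ closure A, I x)

/-! ### The model -/

/-- `B` is a standard Brownian motion on the time interval `[0, 1]`: it starts at `0`, has
independent increments, `B t - B s` has law `N(0, t - s)`, and almost all its paths are
continuous. The values of `B` outside `[0, 1]` play no role. -/
structure IsUnitBrownian {Ω : Type*} [MeasurableSpace Ω] (P : Measure Ω) (B : ℝ → Ω → ℝ) :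
    Prop where
  start : ∀ᵐ ω ∂P, B 0 ω = 0
  indep : HasIndepIncrements (fun (t : Set.Icc (0 : ℝ) 1) ω => B t ω) P
  law : ∀ s t : ℝ, 0 ≤ s → s ≤ t → t ≤ 1 →
    HasLaw (fun ω => B t ω - B s ω) (gaussianReal 0 (t - s).toNNReal) P
  cont : ∀ᵐ ω ∂P, ContinuousOn (fun t => B t ω) (Set.Icc 0 1)

/-- The processes `B` and `B'`, with times in `[0, 1]`, are independent. -/
def IndepUnitProcesses {Ω : Type*} [MeasurableSpace Ω] (P : Measure Ω) (B B' : ℝ → Ω → ℝ) : Prop :=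
  IndepFun (fun ω (t : Set.Icc (0 : ℝ) 1) => B t ω) (fun ω (t : Set.Icc (0 : ℝ) 1) => B' t ω) P

/-- The drift `b` belongs to `L^∞([0, 1] × Ω, dt ⊗ P)`. -/
def BoundedDrift {Ω : Type*} [MeasurableSpace Ω] (P : Measure Ω) (b : ℝ → Ω → ℝ) : Prop :=
  MemLp (fun p : ℝ × Ω => b p.1 p.2) ∞ ((volume.restrict (Set.Icc (0 : ℝ) 1)).prod P)

/-- `dX_t = σ dB_t + b(t, ω) dt` on `[0, 1]` with a constant `σ`, in integrated form
(the stochastic integral of a constant is `σ (B_t - B_0)`). -/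
def IsItoProcess {Ω : Type*} [MeasurableSpace Ω] (P : Measure Ω) (σ : ℝ) (B b X : ℝ → Ω → ℝ) :
    Prop :=
  ∀ t : ℝ, 0 ≤ t → t ≤ 1 →
    ∀ᵐ ω ∂P, X t ω = X 0 ω + σ * (B t ω - B 0 ω) + ∫ s in (0 : ℝ)..t, b s ω

/-! ### Realized (co-)volatility and realized correlation -/

/-- The increment `X_{k/n} - X_{(k-1)/n}`. -/
noncomputable def increment {Ω : Type*} (X : ℝ → Ω → ℝ) (n k : ℕ) (ω : Ω) : ℝ :=
  X ((k : ℝ) / n) ω - X (((k : ℝ) - 1) / n) ω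

/-- The realized covolatility `∑_{k = 1}^{[nt]} (Δ_k X) (Δ_k Y)`. -/
noncomputable def realizedCov {Ω : Type*} (X Y : ℝ → Ω → ℝ) (t : ℝ) (n : ℕ) (ω : Ω) : ℝ :=
  ∑ k ∈ Finset.Icc 1 ⌊(n : ℝ) * t⌋₊, increment X n k ω * increment Y n k ω

/-- The realized volatility `∑_{k = 1}^{[nt]} (Δ_k X)²`. -/
noncomputable def realizedVol {Ω : Type*} (X : ℝ → Ω → ℝ) (t : ℝ) (n : ℕ) (ω : Ω) : ℝ :=
  ∑ k ∈ Finset.Icc 1 ⌊(n : ℝ) * t⌋₊, increment X n k ω ^ 2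

/-- The realized correlation up to time `t` (with value `0` where a realized volatility
vanishes). -/
noncomputable def realizedCorr {Ω : Type*} (X Y : ℝ → Ω → ℝ) (t : ℝ) (n : ℕ) (ω : Ω) : ℝ :=
  realizedCov X Y t n ω / √(realizedVol X t n ω * realizedVol Y t n ω)

open Classical in
/-- The rate function of the realized correlation. -/
noncomputable def corrRate (ρ : ℝ) (u : ℝ) : EReal :=
  if -1 < u ∧ u < 1 then
    ((Real.log ((1 - ρ * u) / (√(1 - ρ ^ 2) * √(1 - u ^ 2))) : ℝ) : EReal)
  else ⊤

/-! ### The rate function -/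

/-! Correlation is scale invariant, so the `σ`'s drop out. The vector of increments of `X_ℓ` differs
from `σ_ℓ` times that of `B_ℓ` by at most `C/√n` in Euclidean norm. As long as both realized
volatilities of the Brownian motions exceed some `δ > 0`, the drift therefore moves the correlation
by `O(1/√n)`, uniformly in `ω` up to null sets (`isApproxCorr_realizedCorr`). It remains to study `b
/ √(a c)` for the Gram entries `(a, b, c)` of the Brownian increments. Only their Laplace transform,
`quadDet` to the power `-n/2`, is used (`isGaussianGram_brownian`).

Upper bound: for `w > 0`, AM-GM turns `b ≥ w √(a c)` into a union over `l > 0` of the half-spaces `b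
≥ w (l a + c / l) / 2`. Chernoff's inequality with one `θ` bounds each by `exp (-n I(w))`
(`IsGaussianGram.measure_linear_le`). Once `a` and `c` lie in a compact part of `(0, ∞)`, finitely
many `l` suffice, at the price of a slightly smaller `w`. For `w ≤ 0` the value `l = 1` suffices.
Deviations to the left of `ρ` follow by changing the sign of `b`.

Lower bound: the exponential tilt by `θ (b - w (a + c) / 2)` makes `(a, b, c)` concentrate at a
point of correlation `w`. On a small box around that point the tilt is nearly constant, and outside
it the tilted mass is exponentially smaller (`IsGaussianGram.eventually_le_measure`). -/

/-- The finite part of `corrRate`. -/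
noncomputable def corrRateReal (ρ u : ℝ) : ℝ :=
  Real.log ((1 - ρ * u) / (√(1 - ρ ^ 2) * √(1 - u ^ 2)))

theorem corrRate_of_mem {ρ u : ℝ} (h : -1 < u) (h' : u < 1) :
    corrRate ρ u = (corrRateReal ρ u : EReal) := by
  simp [corrRate, corrRateReal, h, h']

theorem one_sub_sq_pos {u : ℝ} (h : -1 < u) (h' : u < 1) : 0 < 1 - u ^ 2 := by nlinarith

theorem one_sub_mul_pos {ρ u : ℝ} (hρ : -1 < ρ) (hρ' : ρ < 1) (h : -1 ≤ u) (h' : u ≤ 1) :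
    0 < 1 - ρ * u := by
  rcases le_total 0 ρ with h0 | h0 <;> nlinarith

theorem corrRateReal_eq {ρ u : ℝ} (hρ : -1 < ρ) (hρ' : ρ < 1) (h : -1 < u) (h' : u < 1) :
    corrRateReal ρ u = Real.log ((1 - ρ * u) ^ 2 / ((1 - ρ ^ 2) * (1 - u ^ 2))) / 2 := by
  have h1 := one_sub_sq_pos hρ hρ'
  have h2 := one_sub_sq_pos h h'
  have : (1 - ρ * u) ^ 2 / ((1 - ρ ^ 2) * (1 - u ^ 2)) =
      ((1 - ρ * u) / (√(1 - ρ ^ 2) * √(1 - u ^ 2))) ^ 2 := by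
    rw [div_pow, mul_pow, Real.sq_sqrt h1.le, Real.sq_sqrt h2.le]
  rw [this, Real.log_pow, corrRateReal]
  push_cast
  ring

/-- Squaring and clearing denominators leaves a polynomial inequality, which stays continuous at `u
= ±1`, where the rate itself blows up. -/
theorem lt_corrRateReal_iff {ρ u : ℝ} (hρ : -1 < ρ) (hρ' : ρ < 1) (h : -1 < u) (h' : u < 1)
    (c : ℝ) :
    c < corrRateReal ρ u ↔
      Real.exp (2 * c) * ((1 - ρ ^ 2) * (1 - u ^ 2)) < (1 - ρ * u) ^ 2 := by
  have h1 := one_sub_sq_pos hρ hρ'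
  have h2 := one_sub_sq_pos h h'
  have h3 := one_sub_mul_pos hρ hρ' h.le h'.le
  rw [corrRateReal_eq hρ hρ' h h', lt_div_iff₀ two_pos, Real.lt_log_iff_exp_lt (by positivity),
    lt_div_iff₀ (by positivity), mul_comm c]

theorem corrRateReal_nonneg {ρ u : ℝ} (hρ : -1 < ρ) (hρ' : ρ < 1) (h : -1 < u) (h' : u < 1) :
    0 ≤ corrRateReal ρ u := by
  have h1 := one_sub_sq_pos hρ hρ'
  have h2 := one_sub_sq_pos h h'
  rw [corrRateReal_eq hρ hρ' h h']
  refine div_nonneg (Real.log_nonneg ?_) two_pos.le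
  rw [one_le_div (by positivity)]
  nlinarith [sq_nonneg (u - ρ)]

theorem corrRateReal_self {ρ : ℝ} (hρ : -1 < ρ) (hρ' : ρ < 1) : corrRateReal ρ ρ = 0 := by
  have h1 := one_sub_sq_pos hρ hρ'
  rw [corrRateReal_eq hρ hρ' hρ hρ', ← sq, ← sq, div_self (by positivity)]
  simp

theorem corrRate_neg_neg (ρ u : ℝ) : corrRate (-ρ) (-u) = corrRate ρ u := by
  have : (-1 < -u ∧ -u < 1) ↔ (-1 < u ∧ u < 1) := by
    constructor <;> rintro ⟨h1, h2⟩ <;> constructor <;> linarith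
  simp only [corrRate, this, neg_mul_neg, neg_sq]

theorem setOf_corrRate_le {ρ : ℝ} (hρ : -1 < ρ) (hρ' : ρ < 1) (c : ℝ) :
    {u | corrRate ρ u ≤ (c : EReal)} = Set.Icc (-1) 1 ∩
      {u | (1 - ρ * u) ^ 2 ≤ Real.exp (2 * c) * ((1 - ρ ^ 2) * (1 - u ^ 2))} := by
  ext u
  simp only [Set.mem_ofPred_eq, Set.mem_inter_iff, Set.mem_Icc]
  by_cases hu : -1 < u ∧ u < 1
  · rw [corrRate_of_mem hu.1 hu.2, EReal.coe_le_coe_iff, ← not_lt,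
      lt_corrRateReal_iff hρ hρ' hu.1 hu.2, not_lt]
    simp [hu.1.le, hu.2.le]
  · have : corrRate ρ u = ⊤ := by simp only [corrRate, hu, if_false]
    simp only [this, top_le_iff, EReal.coe_ne_top, false_iff]
    -- At `u = ±1` the right side vanishes while `(1 - ρ u)²` is positive, so the polynomial
    -- inequality already excludes the endpoints.
    rintro ⟨⟨h1, h2⟩, h3⟩
    have h4 := one_sub_mul_pos hρ hρ' h1 h2
    have h5 : 1 - u ^ 2 = 0 := by
      by_contra h
      refine hu ⟨lt_of_le_of_ne h1 ?_, lt_of_le_of_ne h2 ?_⟩ <;>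
        · rintro rfl
          norm_num at h
    rw [h5, mul_zero, mul_zero] at h3
    nlinarith

theorem isGoodRateFunction_corrRate {ρ : ℝ} (hρ : -1 < ρ) (hρ' : ρ < 1) :
    IsGoodRateFunction (corrRate ρ) := by
  have key : ∀ c : ℝ, IsClosed {u : ℝ | (1 - ρ * u) ^ 2 ≤
      Real.exp (2 * c) * ((1 - ρ ^ 2) * (1 - u ^ 2))} := fun c =>
    isClosed_le (by fun_prop) (by fun_prop)
  refine ⟨⟨fun u => ?_, fun c _ => ?_⟩, fun c _ => ?_⟩
  · by_cases hu : -1 < u ∧ u < 1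
    · rw [corrRate_of_mem hu.1 hu.2]
      exact_mod_cast corrRateReal_nonneg hρ hρ' hu.1 hu.2
    · simp [corrRate, hu]
  · rw [setOf_corrRate_le hρ hρ']
    exact isClosed_Icc.inter (key c)
  · rw [setOf_corrRate_le hρ hρ']
    exact isCompact_Icc.inter_right (key c)

/-- Below every point to the right of `ρ` there is one where the rate is almost as large. -/
theorem exists_lt_corrRateReal {ρ : ℝ} (hρ : -1 < ρ) (hρ' : ρ < 1) {u c : ℝ} (hu : ρ < u)
    (hc : (c : EReal) < corrRate ρ u) :
    ∃ w, ρ < w ∧ w < u ∧ w < 1 ∧ c < corrRateReal ρ w := by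
  have hm : ρ < min u 1 := lt_min hu hρ'
  -- For `u ≥ 1` the polynomial inequality is used at `1`, where its left side is `0`; openness then
  -- supplies a point `w < 1`.
  have h1 : Real.exp (2 * c) * ((1 - ρ ^ 2) * (1 - min u 1 ^ 2)) < (1 - ρ * min u 1) ^ 2 := by
    rcases lt_or_ge u 1 with h | h
    · rw [min_eq_left h.le]
      rw [corrRate_of_mem (hρ.trans hu) h, EReal.coe_lt_coe_iff] at hc
      exact (lt_corrRateReal_iff hρ hρ' (hρ.trans hu) h c).1 hc
    · rw [min_eq_right h]
      have : 0 < 1 - ρ := by linarith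
      have : 0 < (1 - ρ) ^ 2 := by positivity
      simpa using this
  have h2 : ∀ᶠ w in 𝓝 (min u 1),
      Real.exp (2 * c) * ((1 - ρ ^ 2) * (1 - w ^ 2)) < (1 - ρ * w) ^ 2 :=
    (isOpen_lt (by fun_prop) (by fun_prop)).mem_nhds h1
  have h3 : ∀ᶠ w in 𝓝[<] (min u 1), ρ < w ∧ w < min u 1 := Ioo_mem_nhdsLT hm
  obtain ⟨w, hw, hw'⟩ := ((h2.filter_mono nhdsWithin_le_nhds).and h3).exists
  have hw1 := hw'.2.trans_le (min_le_right _ _)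
  exact ⟨w, hw'.1, hw'.2.trans_le (min_le_left _ _), hw1,
    (lt_corrRateReal_iff hρ hρ' (hρ.trans hw'.1) hw1 c).2 hw⟩

/-! ### The exponential moments of a Gaussian Gram matrix -/

/-- `E exp(α x² + β x y + κ y²) = (quadDet ρ α β κ)^{-1/2}` for standard normal variables `x`, `y`
with correlation `ρ`. -/
def quadDet (ρ α β κ : ℝ) : ℝ :=
  1 - 2 * α - 2 * κ - 2 * ρ * β + (1 - ρ ^ 2) * (4 * α * κ - β ^ 2)

/-- The coefficients for which `E exp(α x² + β x y + κ y²)` is finite. -/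
def QuadDomain (ρ α β κ : ℝ) : Prop :=
  0 < 1 - 2 * κ * (1 - ρ ^ 2) ∧ 0 < quadDet ρ α β κ

/-- `(a n, b n, c n)` has the exponential moments of the entries `(S₁₁, S₁₂, S₂₂)` of the
normalized Gram matrix of `n` independent pairs of standard normals with correlation `ρ`. -/
structure IsGaussianGram {Ω : Type*} [MeasurableSpace Ω] (P : Measure Ω) (ρ : ℝ)
    (a b c : ℕ → Ω → ℝ) : Prop where
  aemeasurable_a : ∀ n, 0 < n → AEMeasurable (a n) P
  aemeasurable_b : ∀ n, 0 < n → AEMeasurable (b n) P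
  aemeasurable_c : ∀ n, 0 < n → AEMeasurable (c n) P
  lintegral_exp : ∀ n, 0 < n → ∀ α β κ, QuadDomain ρ α β κ →
    ∫⁻ ω, ENNReal.ofReal (Real.exp (n * (α * a n ω + β * b n ω + κ * c n ω))) ∂P =
      ENNReal.ofReal (Real.exp (-(n * (Real.log (quadDet ρ α β κ) / 2))))

section GaussianGram

variable {Ω : Type*} [MeasurableSpace Ω] {P : Measure Ω} {ρ : ℝ} {a b c : ℕ → Ω → ℝ}

/-- This reflection reduces deviations to the left of `ρ` to deviations to the right. -/
theorem IsGaussianGram.neg (H : IsGaussianGram P ρ a b c) :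
    IsGaussianGram P (-ρ) a (fun n ω => -b n ω) c where
  aemeasurable_a := H.aemeasurable_a
  aemeasurable_b n hn := (H.aemeasurable_b n hn).neg
  aemeasurable_c := H.aemeasurable_c
  lintegral_exp n hn α β κ hd := by
    have hq : quadDet (-ρ) α β κ = quadDet ρ α (-β) κ := by simp only [quadDet]; ring
    have hd' : QuadDomain ρ α (-β) κ := ⟨by simpa using hd.1, hq ▸ hd.2⟩
    rw [hq, ← H.lintegral_exp n hn _ _ _ hd']
    simp

/-- The exponential Markov inequality for linear functionals of the Gram matrix. -/
theorem IsGaussianGram.measure_le (H : IsGaussianGram P ρ a b c) {n : ℕ} (hn : 0 < n)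
    {α β κ : ℝ} (hd : QuadDomain ρ α β κ) (s : ℝ) :
    P {ω | s ≤ α * a n ω + β * b n ω + κ * c n ω} ≤
      ENNReal.ofReal (Real.exp (-(n * (s + Real.log (quadDet ρ α β κ) / 2)))) := by
  have hn' : (0 : ℝ) < n := by exact_mod_cast hn
  have ha := H.aemeasurable_a n hn
  have hb := H.aemeasurable_b n hn
  have hc := H.aemeasurable_c n hn
  have hm : AEMeasurable
      (fun ω => ENNReal.ofReal (Real.exp (n * (α * a n ω + β * b n ω + κ * c n ω)))) P := by
    fun_prop
  have h := mul_meas_ge_le_lintegral₀ hm (ENNReal.ofReal (Real.exp (n * s)))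
  rw [H.lintegral_exp n hn α β κ hd] at h
  have hset : {ω | s ≤ α * a n ω + β * b n ω + κ * c n ω} ⊆
      {ω | ENNReal.ofReal (Real.exp (n * s)) ≤
        ENNReal.ofReal (Real.exp (n * (α * a n ω + β * b n ω + κ * c n ω)))} := by
    intro ω hω
    have hω' : s ≤ α * a n ω + β * b n ω + κ * c n ω := hω
    exact ENNReal.ofReal_le_ofReal (Real.exp_le_exp.2 (mul_le_mul_of_nonneg_left hω' hn'.le))
  calc P {ω | s ≤ α * a n ω + β * b n ω + κ * c n ω}
      = ENNReal.ofReal (Real.exp (-(n * s))) * (ENNReal.ofReal (Real.exp (n * s)) *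
          P {ω | s ≤ α * a n ω + β * b n ω + κ * c n ω}) := by
        rw [← mul_assoc, ← ENNReal.ofReal_mul (Real.exp_pos _).le, ← Real.exp_add]
        simp
    _ ≤ ENNReal.ofReal (Real.exp (-(n * s))) *
          ENNReal.ofReal (Real.exp (-(n * (Real.log (quadDet ρ α β κ) / 2)))) := by
        gcongr
        exact (mul_le_mul_right (measure_mono hset) _).trans h
    _ = _ := by
        rw [← ENNReal.ofReal_mul (Real.exp_pos _).le, ← Real.exp_add]
        congr 2
        ring

/-- Outside an event of superexponentially small probability the diagonal of the Gram matrix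
stays in a compact subset of `(0, ∞)`. -/
theorem IsGaussianGram.exists_measure_le (hρ : -1 < ρ) (hρ' : ρ < 1)
    (H : IsGaussianGram P ρ a b c) (K : ℝ) (hK : 0 ≤ K) :
    ∃ δ > 0, ∃ M ≥ δ, ∀ n : ℕ, 0 < n →
      P {ω | ¬ ((δ ≤ a n ω ∧ a n ω ≤ M) ∧ (δ ≤ c n ω ∧ c n ω ≤ M))} ≤
        4 * ENNReal.ofReal (Real.exp (-(n * K))) := by
  have h1 := one_sub_sq_pos hρ hρ'
  have hE : 1 ≤ Real.exp (2 * (K + 1)) := Real.one_le_exp (by positivity)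
  -- With coefficient `-1/δ` the determinant is `1 + 2/δ = 1 + exp (2 (K + 1))`: Chernoff gains `K +
  -- 1` and loses `1` from the threshold `-1`. For the upper tails, coefficient `1/4` has
  -- determinant `1/2`, whose cost is less than the spare `1` in `M = 4 (K + 1)`.
  set δ := 2 * Real.exp (-(2 * (K + 1))) with hδ
  have hδ0 : 0 < δ := by positivity
  have hinv : δ⁻¹ = Real.exp (2 * (K + 1)) / 2 := by
    rw [hδ, mul_inv, Real.exp_neg, inv_inv]; ring
  have hδ2 : δ ≤ 2 := by
    rw [hδ, Real.exp_neg]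
    have := inv_le_one_of_one_le₀ hE
    linarith
  refine ⟨δ, hδ0, 4 * (K + 1), by linarith, fun n hn => ?_⟩
  have hn' : (0 : ℝ) < n := by exact_mod_cast hn
  have q1 : quadDet ρ (-δ⁻¹) 0 0 = 1 + Real.exp (2 * (K + 1)) := by
    simp only [quadDet, hinv]; ring
  have q2 : quadDet ρ 0 0 (-δ⁻¹) = 1 + Real.exp (2 * (K + 1)) := by
    simp only [quadDet, hinv]; ring
  have q3 : quadDet ρ (1 / 4) 0 0 = 2⁻¹ := by simp only [quadDet]; ring
  have q4 : quadDet ρ 0 0 (1 / 4) = 2⁻¹ := by simp only [quadDet]; ring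
  have l1 : 2 * (K + 1) ≤ Real.log (1 + Real.exp (2 * (K + 1))) := by
    rw [Real.le_log_iff_exp_le (by positivity)]
    linarith
  have l2 : -1 ≤ Real.log (2⁻¹ : ℝ) := by
    rw [Real.log_inv]
    linarith [Real.log_two_lt_d9]
  have e1 := H.measure_le hn (α := -δ⁻¹) (β := 0) (κ := 0)
    ⟨by norm_num, by rw [q1]; positivity⟩ (-1)
  have e2 := H.measure_le hn (α := 0) (β := 0) (κ := -δ⁻¹)
    ⟨by have : 0 < δ⁻¹ := by positivity
        nlinarith, by rw [q2]; positivity⟩ (-1)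
  have e3 := H.measure_le hn (α := 1 / 4) (β := 0) (κ := 0)
    ⟨by norm_num, by rw [q3]; positivity⟩ (K + 1)
  have e4 := H.measure_le hn (α := 0) (β := 0) (κ := 1 / 4)
    ⟨by nlinarith [sq_nonneg ρ], by rw [q4]; positivity⟩ (K + 1)
  rw [q1] at e1
  rw [q2] at e2
  rw [q3] at e3
  rw [q4] at e4
  have mono : ∀ x, K ≤ x → ENNReal.ofReal (Real.exp (-(n * x))) ≤
      ENNReal.ofReal (Real.exp (-(n * K))) := fun x hx => by
    gcongr
  have hsub : {ω | ¬ ((δ ≤ a n ω ∧ a n ω ≤ 4 * (K + 1)) ∧ (δ ≤ c n ω ∧ c n ω ≤ 4 * (K + 1)))} ⊆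
      ({ω | -1 ≤ -δ⁻¹ * a n ω + 0 * b n ω + 0 * c n ω} ∪
        {ω | -1 ≤ 0 * a n ω + 0 * b n ω + -δ⁻¹ * c n ω}) ∪
      ({ω | K + 1 ≤ 1 / 4 * a n ω + 0 * b n ω + 0 * c n ω} ∪
        {ω | K + 1 ≤ 0 * a n ω + 0 * b n ω + 1 / 4 * c n ω}) := by
    intro ω hω
    have aux : ∀ x, x < δ → -1 ≤ -δ⁻¹ * x := fun x hx => by
      have := mul_le_mul_of_nonneg_left hx.le (inv_pos.2 hδ0).le
      rw [inv_mul_cancel₀ hδ0.ne'] at this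
      linarith
    by_contra hcon
    simp only [Set.mem_union, Set.mem_ofPred_eq, not_or, not_le, zero_mul, add_zero, zero_add]
      at hcon
    refine hω ⟨⟨?_, by linarith⟩, ⟨?_, by linarith⟩⟩
    · by_contra h
      linarith [aux _ (not_le.1 h)]
    · by_contra h
      linarith [aux _ (not_le.1 h)]
  refine (measure_mono hsub).trans ((measure_union_le _ _).trans ((add_le_add
    (measure_union_le _ _) (measure_union_le _ _)).trans ?_))
  refine (add_le_add (add_le_add (e1.trans (mono _ (by linarith)))
    (e2.trans (mono _ (by linarith)))) (add_le_add (e3.trans (mono _ (by linarith)))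
    (e4.trans (mono _ (by linarith))))).trans (le_of_eq ?_)
  ring

/-- A finite set of linear inequalities that replaces `u √(a c) ≤ b`. -/
theorem exists_finset_linear_bound {δ M w u : ℝ} (hδ : 0 < δ) (hw : w < u) :
    ∃ Λ : Finset ℝ, (∀ l ∈ Λ, 0 < l ∧ (0 < w ∨ l = 1)) ∧
      ∀ a b c : ℝ, δ ≤ a → a ≤ M → δ ≤ c → c ≤ M → u * √(a * c) ≤ b →
        ∃ l ∈ Λ, 0 ≤ -(w * l / 2) * a + b + -(w / (2 * l)) * c := by
  rcases le_or_gt w 0 with h0 | h0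
  -- For `w ≤ 0`, AM-GM gives `w (a + c) / 2 ≤ w √(a c)`, so `l = 1` alone works.
  · refine ⟨{1}, by simp, fun a b c ha _ hc _ hb => ⟨1, by simp, ?_⟩⟩
    have ha0 := hδ.trans_le ha
    have hc0 := hδ.trans_le hc
    rw [Real.sqrt_mul ha0.le] at hb
    have e1 : w * (a + c) ≤ 2 * (w * (√a * √c)) := by
      nlinarith [mul_nonneg (neg_nonneg.2 h0) (sq_nonneg (√a - √c)), Real.sq_sqrt ha0.le,
        Real.sq_sqrt hc0.le]
    have e2 : w * (√a * √c) ≤ u * (√a * √c) := by gcongr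
    linarith
  -- With `t = √(c/a)` the required inequality reads `w (l² + t²) ≤ 2 u l t`. It is strict at `t =
  -- l` because `0 < w < u`, hence holds near `l`, and compactness of the range of `t` leaves
  -- finitely many `l`.
  · have hU : ∀ l ∈ Set.Icc (√(δ / M)) (√(M / δ)) ∩ Set.Ioi 0,
        {t : ℝ | 0 < t ∧ w * (l * l + t * t) < u * (2 * (l * t))} ∈ 𝓝 l := by
      intro l hl
      have hl0 : 0 < l := hl.2
      have h1 : ∀ᶠ t in 𝓝 l, w * (l * l + t * t) < u * (2 * (l * t)) := by
        refine (isOpen_lt (by fun_prop) (by fun_prop)).mem_nhds ?_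
        have : 0 < l * l := by positivity
        show w * (l * l + l * l) < u * (2 * (l * l))
        nlinarith
      exact (eventually_gt_nhds hl0).and h1
    rcases lt_or_ge M δ with hM | hM
    · refine ⟨∅, by simp, fun a b c ha ha' => ?_⟩
      linarith
    have hM0 := hδ.trans_le hM
    have hpos : 0 < √(δ / M) := Real.sqrt_pos.2 (by positivity)
    have hEq : Set.Icc (√(δ / M)) (√(M / δ)) ∩ Set.Ioi 0 = Set.Icc (√(δ / M)) (√(M / δ)) :=
      Set.inter_eq_left.2 fun t ht => hpos.trans_le ht.1
    rw [hEq] at hU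
    obtain ⟨Λ, hΛ, hcov⟩ := isCompact_Icc.elim_nhds_subcover _ hU
    refine ⟨Λ, fun l hl => ⟨hpos.trans_le (hΛ l hl).1, Or.inl h0⟩, ?_⟩
    intro a b c ha ha' hc hc' hb
    have ha0 := hδ.trans_le ha
    have hc0 := hδ.trans_le hc
    have ht : √(c / a) ∈ Set.Icc (√(δ / M)) (√(M / δ)) := by
      constructor <;> gcongr
    obtain ⟨-, l, hl, htl⟩ : 0 < c / a ∧ ∃ l ∈ Λ,
        w * (l * l + √(c / a) * √(c / a)) < u * (2 * (l * √(c / a))) := by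
      simpa using hcov ht
    have hl0 : 0 < l := hpos.trans_le (hΛ l hl).1
    refine ⟨l, hl, ?_⟩
    have e1 : √(c / a) * √(c / a) = c / a := Real.mul_self_sqrt (by positivity)
    have e2 : √(a * c) = a * √(c / a) := by
      rw [show a * c = a ^ 2 * (c / a) by field_simp, Real.sqrt_mul (by positivity),
        Real.sqrt_sq ha0.le]
    rw [e2] at hb
    have e3 : -(w * l / 2) * a + b + -(w / (2 * l)) * c =
        b - w * (l * l + c / a) * (a / (2 * l)) := by
      field_simp
      ring
    rw [e3, sub_nonneg]
    refine le_trans ?_ hb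
    rw [e1] at htl
    calc w * (l * l + c / a) * (a / (2 * l)) ≤ u * (2 * (l * √(c / a))) * (a / (2 * l)) := by
          gcongr
      _ = u * (a * √(c / a)) := by field_simp

/-- The tilt that makes the correlation `w` typical. -/
noncomputable def tiltParam (ρ w : ℝ) : ℝ := (w - ρ) / ((1 - ρ ^ 2) * (1 - w ^ 2))

/-- `tiltParam` maximizes the determinant along the line `θ (b - w (a + c) / 2)`. The maximum is
`exp (2 I(w))`, so Chernoff's inequality at threshold `0` yields exactly the rate. -/
theorem quadDet_tilt {w : ℝ} (hρ : -1 < ρ) (hρ' : ρ < 1) (hw : -1 < w) (hw' : w < 1) :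
    quadDet ρ (-(w * tiltParam ρ w / 2)) (tiltParam ρ w) (-(w * tiltParam ρ w / 2)) =
      (1 - ρ * w) ^ 2 / ((1 - ρ ^ 2) * (1 - w ^ 2)) := by
  have h1 := one_sub_sq_pos hρ hρ'
  have h2 := one_sub_sq_pos hw hw'
  simp only [quadDet, tiltParam]
  field_simp
  ring

theorem quadDomain_tilt {w : ℝ} (hρ : -1 < ρ) (hρ' : ρ < 1) (hw : -1 < w) (hw' : w < 1) :
    QuadDomain ρ (-(w * tiltParam ρ w / 2)) (tiltParam ρ w) (-(w * tiltParam ρ w / 2)) := by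
  have h1 := one_sub_sq_pos hρ hρ'
  have h2 := one_sub_sq_pos hw hw'
  have h3 := one_sub_mul_pos hρ hρ' hw.le hw'.le
  refine ⟨?_, ?_⟩
  · have : 1 - 2 * -(w * tiltParam ρ w / 2) * (1 - ρ ^ 2) = (1 - ρ * w) / (1 - w ^ 2) := by
      simp only [tiltParam]
      field_simp
      ring
    rw [this]
    positivity
  · rw [quadDet_tilt hρ hρ' hw hw']
    positivity

theorem IsGaussianGram.measure_linear_le (hρ : -1 < ρ) (hρ' : ρ < 1)
    (H : IsGaussianGram P ρ a b c) {n : ℕ} (hn : 0 < n) {w l : ℝ} (hw : ρ < w) (hw' : w < 1)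
    (hl : 0 < l) (hwl : 0 < w ∨ l = 1) :
    P {ω | 0 ≤ -(w * l / 2) * a n ω + b n ω + -(w / (2 * l)) * c n ω} ≤
      ENNReal.ofReal (Real.exp (-(n * corrRateReal ρ w))) := by
  have h1 := one_sub_sq_pos hρ hρ'
  have h2 := one_sub_sq_pos (hρ.trans hw) hw'
  have h3 := one_sub_mul_pos hρ hρ' (hρ.trans hw).le hw'.le
  set θ := tiltParam ρ w with hθ
  have hθ0 : 0 < θ := by
    have : 0 < w - ρ := sub_pos.2 hw
    rw [hθ, tiltParam]
    positivity
  have hQ : QuadDomain ρ (-(w * θ / 2)) θ (-(w * θ / 2)) :=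
    quadDomain_tilt hρ hρ' (hρ.trans hw) hw'
  -- The product of the outer coefficients does not depend on `l`; only the linear terms do, through
  -- `θ w (l + 1/l)`, which for `w > 0` is smallest at `l = 1`.
  have hdet : quadDet ρ (-(w * θ / 2)) θ (-(w * θ / 2)) ≤
      quadDet ρ (θ * -(w * l / 2)) θ (θ * -(w / (2 * l))) := by
    rcases hwl with hw0 | rfl
    · have e : quadDet ρ (θ * -(w * l / 2)) θ (θ * -(w / (2 * l))) -
          quadDet ρ (-(w * θ / 2)) θ (-(w * θ / 2)) = θ * w * (l - 1) ^ 2 / l := by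
        simp only [quadDet]
        field_simp
        ring
      have : 0 ≤ θ * w * (l - 1) ^ 2 / l := by positivity
      linarith
    · apply le_of_eq
      congr 1 <;> ring
  have hD : QuadDomain ρ (θ * -(w * l / 2)) θ (θ * -(w / (2 * l))) := by
    refine ⟨?_, hQ.2.trans_le hdet⟩
    rcases hwl with hw0 | rfl
    · have : 0 < θ * (w / (2 * l)) * (1 - ρ ^ 2) := by positivity
      linarith
    · convert hQ.1 using 3
      ring
  have key := H.measure_le hn hD 0
  have hset : {ω | 0 ≤ -(w * l / 2) * a n ω + b n ω + -(w / (2 * l)) * c n ω} ⊆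
      {ω | 0 ≤ θ * -(w * l / 2) * a n ω + θ * b n ω + θ * -(w / (2 * l)) * c n ω} := by
    intro ω hω
    rw [Set.mem_ofPred_eq] at hω ⊢
    linarith [mul_nonneg hθ0.le hω]
  refine (measure_mono hset).trans (key.trans ?_)
  rw [corrRateReal_eq hρ hρ' (hρ.trans hw) hw', ← quadDet_tilt hρ hρ' (hρ.trans hw) hw', zero_add]
  have := hQ.2
  gcongr

/-! ### Exponential decay rates -/

theorem eventually_const_mul_exp_le {x y : ℝ} (h : x < y) (C : ℝ≥0∞) (hC : C ≠ ∞) :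
    ∀ᶠ n : ℕ in atTop, C * ENNReal.ofReal (Real.exp (-(n * y))) ≤
      ENNReal.ofReal (Real.exp (-(n * x))) := by
  have h1 : Tendsto (fun n : ℕ => (n : ℝ) * (y - x)) atTop atTop :=
    tendsto_natCast_atTop_atTop.atTop_mul_const (sub_pos.2 h)
  filter_upwards [(Real.tendsto_exp_atTop.comp h1).eventually_ge_atTop C.toReal] with n hn
  rw [← ENNReal.ofReal_toReal hC, ← ENNReal.ofReal_mul ENNReal.toReal_nonneg]
  apply ENNReal.ofReal_le_ofReal
  calc C.toReal * Real.exp (-(n * y))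
      ≤ Real.exp (n * (y - x)) * Real.exp (-(n * y)) := by
        gcongr
        exact hn
    _ = Real.exp (-(n * x)) := by
        rw [← Real.exp_add]
        congr 1
        ring

theorem limsup_log_div_le {p : ℕ → ℝ≥0∞} {x : ℝ}
    (h : ∀ᶠ n : ℕ in atTop, p n ≤ ENNReal.ofReal (Real.exp (-(n * x)))) :
    limsup (fun n : ℕ => ENNReal.log (p n) / ((n : ℝ) : EReal)) atTop ≤
      ((-x : ℝ) : EReal) := by
  refine limsup_le_of_le (by isBoundedDefault) ?_
  filter_upwards [h, eventually_gt_atTop 0] with n hn hn0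
  have hn' : (0 : ℝ) < n := by exact_mod_cast hn0
  rw [EReal.div_le_iff_le_mul (by exact_mod_cast hn') (EReal.coe_ne_top _)]
  refine (ENNReal.log_le_log hn).trans ?_
  rw [ENNReal.log_ofReal_of_pos (Real.exp_pos _), Real.log_exp, ← EReal.coe_mul,
    EReal.coe_le_coe_iff]
  linarith

theorem le_liminf_log_div {p : ℕ → ℝ≥0∞} {x : ℝ}
    (h : ∀ᶠ n : ℕ in atTop, ENNReal.ofReal (Real.exp (-(n * x))) ≤ p n) :
    ((-x : ℝ) : EReal) ≤
      liminf (fun n : ℕ => ENNReal.log (p n) / ((n : ℝ) : EReal)) atTop := by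
  refine le_liminf_of_le (by isBoundedDefault) ?_
  filter_upwards [h, eventually_gt_atTop 0] with n hn hn0
  have hn' : (0 : ℝ) < n := by exact_mod_cast hn0
  rw [EReal.le_div_iff_mul_le (by exact_mod_cast hn') (EReal.coe_ne_top _)]
  refine le_trans ?_ (ENNReal.log_le_log hn)
  rw [ENNReal.log_ofReal_of_pos (Real.exp_pos _), Real.log_exp, ← EReal.coe_mul,
    EReal.coe_le_coe_iff]
  linarith

/-! ### Upper bounds -/

/-- `R` is uniformly close to the correlation `b / √(a c)` as long as `a` and `c` stay away
from `0`. -/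
def IsApproxCorr (P : Measure Ω) (a b c R : ℕ → Ω → ℝ) : Prop :=
  ∀ δ > 0, ∀ ε > 0, ∀ᶠ n : ℕ in atTop, ∀ᵐ ω ∂P, δ ≤ a n ω → δ ≤ c n ω →
    |R n ω - b n ω / √(a n ω * c n ω)| ≤ ε

theorem IsApproxCorr.neg {R : ℕ → Ω → ℝ} (h : IsApproxCorr P a b c R) :
    IsApproxCorr P a (fun n ω => -b n ω) c (fun n ω => -R n ω) := by
  intro δ hδ ε hε
  filter_upwards [h δ hδ ε hε] with n hn
  filter_upwards [hn] with ω hω ha hc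
  have := hω ha hc
  rwa [neg_div, neg_sub_neg, abs_sub_comm]

theorem IsGaussianGram.eventually_measure_ge_le (hρ : -1 < ρ) (hρ' : ρ < 1)
    (H : IsGaussianGram P ρ a b c) {R : ℕ → Ω → ℝ} (hR : IsApproxCorr P a b c R) {u x : ℝ}
    (hu : ρ < u) (hx : (x : EReal) < corrRate ρ u) :
    ∀ᶠ n : ℕ in atTop, P {ω | u ≤ R n ω} ≤ ENNReal.ofReal (Real.exp (-(n * x))) := by
  -- The gaps in `w < v < u` pay for two losses: `u - v` for the approximation of `R`, `v - w` for
  -- the finite family of half-spaces. The gap `x < I(w)` absorbs the number of events in the union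
  -- bound.
  obtain ⟨w, hρw, hwu, hw1, hxw⟩ := exists_lt_corrRateReal hρ hρ' hu hx
  obtain ⟨v, hwv, hvu⟩ := exists_between hwu
  obtain ⟨δ, hδ, M, hM, hbad⟩ :=
    H.exists_measure_le hρ hρ' (corrRateReal ρ w) (corrRateReal_nonneg hρ hρ' (hρ.trans hρw) hw1)
  obtain ⟨Λ, hΛ, hlin⟩ := exists_finset_linear_bound (M := M) hδ hwv
  have hC : (4 + (Λ.card : ℝ≥0∞)) ≠ ∞ := by finiteness
  filter_upwards [hR δ hδ (u - v) (sub_pos.2 hvu), eventually_const_mul_exp_le hxw _ hC,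
    eventually_gt_atTop 0] with n hn hexp hn0
  refine le_trans ?_ hexp
  have hsub : {ω | u ≤ R n ω} ≤ᵐ[P]
      ({ω | ¬ ((δ ≤ a n ω ∧ a n ω ≤ M) ∧ (δ ≤ c n ω ∧ c n ω ≤ M))} ∪
      ⋃ l ∈ Λ, {ω | 0 ≤ -(w * l / 2) * a n ω + b n ω + -(w / (2 * l)) * c n ω} : Set Ω) := by
    filter_upwards [hn] with ω hω hωu
    by_cases hg : (δ ≤ a n ω ∧ a n ω ≤ M) ∧ (δ ≤ c n ω ∧ c n ω ≤ M)
    · right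
      have h1 := (abs_le.1 (hω hg.1.1 hg.2.1)).2
      have hωu' : u ≤ R n ω := hωu
      have h2 : 0 < √(a n ω * c n ω) :=
        Real.sqrt_pos.2 (mul_pos (hδ.trans_le hg.1.1) (hδ.trans_le hg.2.1))
      have h3 : v * √(a n ω * c n ω) ≤ b n ω := by
        rw [← le_div_iff₀ h2]
        linarith
      obtain ⟨l, hl, hl'⟩ := hlin _ _ _ hg.1.1 hg.1.2 hg.2.1 hg.2.2 h3
      exact Set.mem_biUnion hl hl'
    · exact Or.inl hg
  calc P {ω | u ≤ R n ω} ≤ _ := measure_mono_ae hsub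
    _ ≤ _ := measure_union_le _ _
    _ ≤ 4 * ENNReal.ofReal (Real.exp (-(n * corrRateReal ρ w))) +
        ∑ l ∈ Λ, ENNReal.ofReal (Real.exp (-(n * corrRateReal ρ w))) := by
      refine add_le_add (hbad n hn0) ((measure_biUnion_finset_le _ _).trans ?_)
      exact Finset.sum_le_sum fun l hl =>
        H.measure_linear_le hρ hρ' hn0 hρw hw1 (hΛ l hl).1 (hΛ l hl).2
    _ = _ := by
      rw [Finset.sum_const, nsmul_eq_mul, add_mul]

theorem IsGaussianGram.eventually_measure_le_le (hρ : -1 < ρ) (hρ' : ρ < 1)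
    (H : IsGaussianGram P ρ a b c) {R : ℕ → Ω → ℝ} (hR : IsApproxCorr P a b c R) {u x : ℝ}
    (hu : u < ρ) (hx : (x : EReal) < corrRate ρ u) :
    ∀ᶠ n : ℕ in atTop, P {ω | R n ω ≤ u} ≤ ENNReal.ofReal (Real.exp (-(n * x))) := by
  have := H.neg.eventually_measure_ge_le (by linarith) (by linarith) hR.neg (u := -u) (x := x)
    (by linarith) (by rwa [corrRate_neg_neg])
  simpa only [neg_le_neg_iff] using this

/-- On each side of `ρ` the event lies in a half-line starting at the point of `closure A` nearest
to `ρ`, so only the rate at these two points matters and no monotonicity of the rate is needed. -/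
theorem IsGaussianGram.limsup_le [IsProbabilityMeasure P] (hρ : -1 < ρ) (hρ' : ρ < 1)
    (H : IsGaussianGram P ρ a b c) {R : ℕ → Ω → ℝ} (hR : IsApproxCorr P a b c R) (A : Set ℝ) :
    limsup (fun n : ℕ => ENNReal.log (P {ω | R n ω ∈ A}) / ((n : ℝ) : EReal)) atTop ≤
      -(⨅ u ∈ closure A, corrRate ρ u) := by
  rw [EReal.le_neg]
  refine EReal.ge_of_forall_gt_iff_ge.1 fun x hx => ?_
  rw [EReal.le_neg, ← EReal.coe_neg]
  apply limsup_log_div_le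
  obtain ⟨y, hxy, hy⟩ := EReal.lt_iff_exists_real_btwn.1 hx
  have hxy' : x < y := by exact_mod_cast hxy
  have hlt : ∀ u ∈ closure A, (y : EReal) < corrRate ρ u := fun u hu =>
    hy.trans_le (iInf₂_le u hu)
  rcases lt_or_ge x 0 with hx0 | hx0
  · refine Eventually.of_forall fun n => prob_le_one.trans ?_
    rw [ENNReal.one_le_ofReal]
    apply Real.one_le_exp
    have : (0 : ℝ) ≤ n := n.cast_nonneg
    nlinarith
  -- The rate vanishes at `ρ`, whereas it exceeds `y > 0` on `closure A`.
  have hρA : ρ ∉ closure A := fun h => by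
    have := hlt ρ h
    rw [corrRate_of_mem hρ hρ', corrRateReal_self hρ hρ', EReal.coe_lt_coe_iff] at this
    linarith
  have right : ∀ᶠ n : ℕ in atTop, P {ω | R n ω ∈ closure A ∩ Set.Ici ρ} ≤
      ENNReal.ofReal (Real.exp (-(n * y))) := by
    rcases (closure A ∩ Set.Ici ρ).eq_empty_or_nonempty with he | hne
    · simp [he]
    · have hbdd : BddBelow (closure A ∩ Set.Ici ρ) := ⟨ρ, fun u hu => hu.2⟩
      have hmem := (isClosed_closure.inter isClosed_Ici).csInf_mem hne hbdd
      have hgt : ρ < sInf (closure A ∩ Set.Ici ρ) :=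
        lt_of_le_of_ne hmem.2 fun h => hρA (h ▸ hmem.1)
      filter_upwards [H.eventually_measure_ge_le hρ hρ' hR hgt (hlt _ hmem.1)] with n hn
      refine le_trans (measure_mono fun ω hω => ?_) hn
      exact csInf_le hbdd hω
  have left : ∀ᶠ n : ℕ in atTop, P {ω | R n ω ∈ closure A ∩ Set.Iic ρ} ≤
      ENNReal.ofReal (Real.exp (-(n * y))) := by
    rcases (closure A ∩ Set.Iic ρ).eq_empty_or_nonempty with he | hne
    · simp [he]
    · have hbdd : BddAbove (closure A ∩ Set.Iic ρ) := ⟨ρ, fun u hu => hu.2⟩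
      have hmem := (isClosed_closure.inter isClosed_Iic).csSup_mem hne hbdd
      have hgt : sSup (closure A ∩ Set.Iic ρ) < ρ :=
        lt_of_le_of_ne hmem.2 fun h => hρA (h ▸ hmem.1)
      filter_upwards [H.eventually_measure_le_le hρ hρ' hR hgt (hlt _ hmem.1)] with n hn
      refine le_trans (measure_mono fun ω hω => ?_) hn
      exact le_csSup hbdd hω
  filter_upwards [left, right, eventually_const_mul_exp_le hxy' 2 (by simp)] with n hl hr hn
  refine le_trans ?_ hn
  rw [two_mul]
  refine le_trans (measure_mono ?_) ((measure_union_le _ _).trans (add_le_add hl hr))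
  intro ω hω
  rcases le_total (R n ω) ρ with h | h
  · exact Or.inl ⟨subset_closure hω, h⟩
  · exact Or.inr ⟨subset_closure hω, h⟩

/-! ### Lower bounds -/

theorem eventually_lt_of_hasDerivAt_pos {f : ℝ → ℝ} {f' x : ℝ} (hf : HasDerivAt f f' x)
    (hf' : 0 < f') : ∀ᶠ y in 𝓝[>] x, f x < f y := by
  have h := (hasDerivAt_iff_tendsto_slope.1 hf).eventually (eventually_gt_nhds hf')
  have h2 : 𝓝[>] x ≤ 𝓝[≠] x := nhdsWithin_mono _ fun y hy => (Set.mem_Ioi.1 hy).ne'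
  filter_upwards [h2 h, self_mem_nhdsWithin] with y hy hxy
  rw [slope_def_field] at hy
  have := (div_pos_iff_of_pos_right (sub_pos.2 hxy)).1 hy
  linarith

/-- A small additional tilt in the direction `(p₁, p₂, p₃)` makes deviations above the mean `m`
of the corresponding functional of the Gram matrix exponentially unlikely. -/
theorem exists_tilt_gap {α β κ m η p₁ p₂ p₃ : ℝ} (hd : QuadDomain ρ α β κ) (hη : 0 < η)
    (hm : p₁ * (1 - 2 * (1 - ρ ^ 2) * κ) + p₂ * (ρ + (1 - ρ ^ 2) * β) +
      p₃ * (1 - 2 * (1 - ρ ^ 2) * α) = m * quadDet ρ α β κ) :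
    ∃ s > 0, QuadDomain ρ (α + s * p₁) (β + s * p₂) (κ + s * p₃) ∧
      Real.log (quadDet ρ α β κ) / 2 <
        s * (m + η) + Real.log (quadDet ρ (α + s * p₁) (β + s * p₂) (κ + s * p₃)) / 2 := by
  -- The hypothesis `hm` says that `m` is the derivative of the log-moment function `-log (quadDet)
  -- / 2` in the direction `p`, that is, the mean under the tilt.
  have hpoly : HasDerivAt (fun s => quadDet ρ (α + s * p₁) (β + s * p₂) (κ + s * p₃))
      (-2 * (m * quadDet ρ α β κ)) 0 := by
    have e : (fun s => quadDet ρ (α + s * p₁) (β + s * p₂) (κ + s * p₃)) = fun s =>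
        quadDet ρ α β κ + s * (-2 * (m * quadDet ρ α β κ)) +
          s ^ 2 * ((1 - ρ ^ 2) * (4 * p₁ * p₃ - p₂ ^ 2)) := by
      funext s
      rw [← hm]
      simp only [quadDet]
      ring
    rw [e]
    have h1 := ((hasDerivAt_id (0 : ℝ)).mul_const (-2 * (m * quadDet ρ α β κ))).const_add
      (quadDet ρ α β κ)
    have h2 := ((hasDerivAt_id (0 : ℝ)).pow 2).mul_const
      ((1 - ρ ^ 2) * (4 * p₁ * p₃ - p₂ ^ 2))
    convert! h1.add h2 using 1
    simp
  -- The slope at `0` is `(m + η) - m = η > 0`, so a small `s > 0` gains strictly.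
  have hderiv : HasDerivAt (fun s => s * (m + η) +
      Real.log (quadDet ρ (α + s * p₁) (β + s * p₂) (κ + s * p₃)) / 2) η 0 := by
    have h1 := hpoly.log (by simpa using hd.2.ne')
    have h2 := ((hasDerivAt_id (0 : ℝ)).mul_const (m + η)).add (h1.div_const 2)
    convert! h2 using 1
    have := hd.2.ne'
    simp only [zero_mul, add_zero]
    field_simp
    ring
  have hdom : ∀ᶠ s in 𝓝[>] (0 : ℝ), QuadDomain ρ (α + s * p₁) (β + s * p₂) (κ + s * p₃) := by
    refine Eventually.filter_mono nhdsWithin_le_nhds (Eventually.and ?_ ?_)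
    · exact (isOpen_lt (by fun_prop) (by fun_prop)).mem_nhds (by simpa using hd.1)
    · exact hpoly.continuousAt.eventually (eventually_gt_nhds (by simpa using hd.2))
  obtain ⟨s, hs, hsd, hs0⟩ := ((eventually_lt_of_hasDerivAt_pos hderiv hη).and
    (hdom.and self_mem_nhdsWithin)).exists
  refine ⟨s, hs0, hsd, ?_⟩
  simp only [zero_mul, add_zero, zero_add] at hs
  linarith

/-- Cramér's change of measure, carried out with unnormalized integrals: the total tilted mass `E =
exp (-n I(w))` is split between a box and its complement. -/
theorem IsGaussianGram.eventually_le_measure (hρ : -1 < ρ) (hρ' : ρ < 1)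
    (H : IsGaussianGram P ρ a b c) {w x η : ℝ} (hw : -1 < w) (hw' : w < 1) (hη : 0 < η)
    (hx : corrRateReal ρ w < x) :
    ∀ᶠ n : ℕ in atTop, ENNReal.ofReal (Real.exp (-(n * x))) ≤
      P {ω | |a n ω - (1 - ρ ^ 2) / (1 - ρ * w)| ≤ η ∧
        |b n ω - w * ((1 - ρ ^ 2) / (1 - ρ * w))| ≤ η ∧
        |c n ω - (1 - ρ ^ 2) / (1 - ρ * w)| ≤ η} := by
  have h1 := one_sub_sq_pos hρ hρ'
  have h2 := one_sub_sq_pos hw hw'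
  have h3 := one_sub_mul_pos hρ hρ' hw.le hw'.le
  set v := (1 - ρ ^ 2) / (1 - ρ * w) with hv
  have hQ := quadDomain_tilt hρ hρ' hw hw'
  have hdet := quadDet_tilt hρ hρ' hw hw'
  have hrate := corrRateReal_eq hρ hρ' hw hw'
  rw [← hdet] at hrate
  have hmean : ∀ p : ℝ × ℝ × ℝ,
      p.1 * (1 - 2 * (1 - ρ ^ 2) * -(w * tiltParam ρ w / 2)) +
        p.2.1 * (ρ + (1 - ρ ^ 2) * tiltParam ρ w) +
        p.2.2 * (1 - 2 * (1 - ρ ^ 2) * -(w * tiltParam ρ w / 2)) =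
      (p.1 * v + p.2.1 * (w * v) + p.2.2 * v) *
        quadDet ρ (-(w * tiltParam ρ w / 2)) (tiltParam ρ w) (-(w * tiltParam ρ w / 2)) := by
    intro p
    rw [hdet, hv]
    simp only [tiltParam]
    field_simp
    ring
  set θ := tiltParam ρ w with hθ
  set ε := (x - corrRateReal ρ w) / 2 with hε
  have hε0 : 0 < ε := by rw [hε]; linarith
  -- The tilt exponent vanishes at `(v, w v, v)` and has size at most `2 |θ| τ ≤ ε` on the box of
  -- radius `τ`; the `+ 1` avoids dividing by zero when `θ = 0`.
  set τ := min η (ε / (2 * (|θ| + 1))) with hτ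
  have hτ0 : 0 < τ := by positivity
  have hτε : 2 * |θ| * τ ≤ ε := by
    have h4 : τ ≤ ε / (2 * (|θ| + 1)) := min_le_right _ _
    rw [le_div_iff₀ (by positivity)] at h4
    nlinarith [abs_nonneg θ]
  choose s hs0 hsd hsl using fun p : ℝ × ℝ × ℝ => exists_tilt_gap hQ hτ0 (hmean p)
  -- The complement of the box is covered by six half-spaces, one for each signed coordinate
  -- direction.
  let dirs : Finset (ℝ × ℝ × ℝ) :=
    {(1, 0, 0), (-1, 0, 0), (0, 1, 0), (0, -1, 0), (0, 0, 1), (0, 0, -1)}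
  have hcard : dirs.card ≠ 0 := Finset.card_ne_zero_of_mem (a := (1, 0, 0)) (by simp [dirs])
  let g : ℝ × ℝ × ℝ → ℝ := fun p => s p * (p.1 * v + p.2.1 * (w * v) + p.2.2 * v + τ) +
    Real.log (quadDet ρ (-(w * θ / 2) + s p * p.1) (θ + s p * p.2.1)
      (-(w * θ / 2) + s p * p.2.2)) / 2
  -- The factor `2 * dirs.card` makes the six tails together at most half of the tilted mass, so the
  -- box carries at least the other half.
  have hev : ∀ᶠ n : ℕ in atTop, ∀ p ∈ dirs, (2 * (dirs.card : ℝ≥0∞)) *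
      ENNReal.ofReal (Real.exp (-(n * g p))) ≤
        ENNReal.ofReal (Real.exp (-(n * corrRateReal ρ w))) := by
    rw [Finset.eventually_all]
    intro p _
    exact eventually_const_mul_exp_le (hrate ▸ hsl p) _ (by finiteness)
  have hxε : corrRateReal ρ w + ε < x := by rw [hε]; linarith
  filter_upwards [hev, eventually_const_mul_exp_le hxε 2 (by simp), eventually_gt_atTop 0]
    with n hn hn2 hn0
  have hn' : (0 : ℝ) < n := by exact_mod_cast hn0
  set D := {ω | |a n ω - v| ≤ τ ∧ |b n ω - w * v| ≤ τ ∧ |c n ω - v| ≤ τ} with hD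
  have hDsub : D ⊆ {ω | |a n ω - v| ≤ η ∧ |b n ω - w * v| ≤ η ∧ |c n ω - v| ≤ η} := by
    intro ω hω
    have : τ ≤ η := min_le_left _ _
    exact ⟨hω.1.trans this, hω.2.1.trans this, hω.2.2.trans this⟩
  refine le_trans ?_ (measure_mono hDsub)
  let F : ℝ × ℝ × ℝ → Ω → ℝ≥0∞ := fun p ω =>
    ENNReal.ofReal (Real.exp (-(n * (s p * (p.1 * v + p.2.1 * (w * v) + p.2.2 * v + τ))))) *
    ENNReal.ofReal (Real.exp (n * ((-(w * θ / 2) + s p * p.1) * a n ω +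
      (θ + s p * p.2.1) * b n ω + (-(w * θ / 2) + s p * p.2.2) * c n ω)))
  have ha := H.aemeasurable_a n hn0
  have hb := H.aemeasurable_b n hn0
  have hc := H.aemeasurable_c n hn0
  have hF : ∀ p, AEMeasurable (F p) P := fun p => by fun_prop
  have hFint : ∀ p, ∫⁻ ω, F p ω ∂P = ENNReal.ofReal (Real.exp (-(n * g p))) := by
    intro p
    simp only [F]
    rw [lintegral_const_mul'' _ (by fun_prop), H.lintegral_exp n hn0 _ _ _ (hsd p),
      ← ENNReal.ofReal_mul (Real.exp_pos _).le, ← Real.exp_add]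
    congr 2
    simp only [g]
    ring
  have hpt : ∀ ω, ENNReal.ofReal
      (Real.exp (n * (-(w * θ / 2) * a n ω + θ * b n ω + -(w * θ / 2) * c n ω))) ≤
      D.indicator (fun _ => ENNReal.ofReal (Real.exp (n * ε))) ω + ∑ p ∈ dirs, F p ω := by
    intro ω
    by_cases hω : ω ∈ D
    · rw [Set.indicator_of_mem hω]
      refine le_add_right (ENNReal.ofReal_le_ofReal (Real.exp_le_exp.2 ?_))
      refine mul_le_mul_of_nonneg_left ?_ hn'.le
      obtain ⟨hωa, hωb, hωc⟩ := hω
      have e : -(w * θ / 2) * a n ω + θ * b n ω + -(w * θ / 2) * c n ω =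
          θ * ((b n ω - w * v) - w / 2 * (a n ω - v) - w / 2 * (c n ω - v)) := by ring
      rw [e]
      refine (le_abs_self _).trans ((abs_mul _ _).le.trans (le_trans ?_ hτε))
      rw [mul_assoc 2, mul_left_comm]
      refine mul_le_mul_of_nonneg_left ?_ (abs_nonneg _)
      have hw2 : |w / 2| ≤ 1 / 2 := by
        rw [abs_le]; constructor <;> linarith
      have hA : |w / 2 * (a n ω - v)| ≤ 1 / 2 * τ := by
        rw [abs_mul]; gcongr
      have hC : |w / 2 * (c n ω - v)| ≤ 1 / 2 * τ := by
        rw [abs_mul]; gcongr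
      calc _ ≤ |b n ω - w * v| + |w / 2 * (a n ω - v)| + |w / 2 * (c n ω - v)| :=
            (abs_sub _ _).trans (add_le_add (abs_sub _ _) le_rfl)
        _ ≤ 2 * τ := by linarith
    · obtain ⟨p, hp, hpω⟩ : ∃ p ∈ dirs, p.1 * v + p.2.1 * (w * v) + p.2.2 * v + τ ≤
          p.1 * a n ω + p.2.1 * b n ω + p.2.2 * c n ω := by
        simp only [hD, Set.mem_ofPred_eq, not_and_or, not_le, lt_abs] at hω
        rcases hω with (h | h) | (h | h) | (h | h)
        · exact ⟨(1, 0, 0), by simp [dirs], by dsimp only; linarith⟩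
        · exact ⟨(-1, 0, 0), by simp [dirs], by dsimp only; linarith⟩
        · exact ⟨(0, 1, 0), by simp [dirs], by dsimp only; linarith⟩
        · exact ⟨(0, -1, 0), by simp [dirs], by dsimp only; linarith⟩
        · exact ⟨(0, 0, 1), by simp [dirs], by dsimp only; linarith⟩
        · exact ⟨(0, 0, -1), by simp [dirs], by dsimp only; linarith⟩
      refine le_add_left (le_trans ?_ (Finset.single_le_sum (f := fun p => F p ω)
        (fun _ _ => zero_le) hp))
      simp only [F]
      rw [← ENNReal.ofReal_mul (Real.exp_pos _).le, ← Real.exp_add]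
      refine ENNReal.ofReal_le_ofReal (Real.exp_le_exp.2 ?_)
      have := mul_le_mul_of_nonneg_left
        (mul_le_mul_of_nonneg_left hpω (hs0 p).le) hn'.le
      linarith
  have hint := lintegral_mono (μ := P) hpt
  rw [H.lintegral_exp n hn0 _ _ _ hQ, ← hrate,
    lintegral_add_right' _ (Finset.aemeasurable_fun_sum _ fun p _ => hF p),
    lintegral_finsetSum' _ fun p _ => hF p] at hint
  simp only [hFint] at hint
  set E := ENNReal.ofReal (Real.exp (-(n * corrRateReal ρ w))) with hE
  have hS : 2 * ∑ p ∈ dirs, ENNReal.ofReal (Real.exp (-(n * g p))) ≤ E := by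
    have h5 := Finset.sum_le_sum hn
    rw [Finset.sum_const, nsmul_eq_mul, ← Finset.mul_sum, mul_comm 2, mul_assoc] at h5
    exact (ENNReal.mul_le_mul_iff_right (by exact_mod_cast hcard) (by simp)).1 h5
  have hmain : E ≤ 2 * (ENNReal.ofReal (Real.exp (n * ε)) * P D) := by
    have h6 : E + E ≤ 2 * (ENNReal.ofReal (Real.exp (n * ε)) * P D) + E := by
      rw [← two_mul]
      calc 2 * E ≤ 2 * (ENNReal.ofReal (Real.exp (n * ε)) * P D +
            ∑ p ∈ dirs, ENNReal.ofReal (Real.exp (-(n * g p)))) := by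
            gcongr
            exact hint.trans (add_le_add (lintegral_indicator_const_le _ _) le_rfl)
        _ ≤ _ := by
            rw [mul_add]
            exact add_le_add le_rfl hS
    exact (ENNReal.add_le_add_iff_right ENNReal.ofReal_ne_top).1 h6
  have h7 : ENNReal.ofReal (Real.exp (-(n * (corrRateReal ρ w + ε)))) ≤ 2 * P D := by
    calc ENNReal.ofReal (Real.exp (-(n * (corrRateReal ρ w + ε))))
        = ENNReal.ofReal (Real.exp (-(n * ε))) * E := by
          rw [hE, ← ENNReal.ofReal_mul (Real.exp_pos _).le, ← Real.exp_add]
          congr 2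
          ring
      _ ≤ ENNReal.ofReal (Real.exp (-(n * ε))) *
          (2 * (ENNReal.ofReal (Real.exp (n * ε)) * P D)) := by gcongr
      _ = (ENNReal.ofReal (Real.exp (-(n * ε))) * ENNReal.ofReal (Real.exp (n * ε))) *
          (2 * P D) := by ring
      _ = 2 * P D := by
          rw [← ENNReal.ofReal_mul (Real.exp_pos _).le, ← Real.exp_add]
          simp
  exact (ENNReal.mul_le_mul_iff_right two_ne_zero (by simp)).1 (hn2.trans h7)

/-- The map `(a, b, c) ↦ b / √(a c)` is continuous at `(v, u v, v)` with value `u`, so a small box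
there forces `R` into a given ball around `u`. -/
theorem IsGaussianGram.le_liminf (hρ : -1 < ρ) (hρ' : ρ < 1)
    (H : IsGaussianGram P ρ a b c) {R : ℕ → Ω → ℝ} (hR : IsApproxCorr P a b c R) (A : Set ℝ) :
    -(⨅ u ∈ interior A, corrRate ρ u) ≤
      liminf (fun n : ℕ => ENNReal.log (P {ω | R n ω ∈ A}) / ((n : ℝ) : EReal)) atTop := by
  rw [EReal.neg_le]
  refine le_iInf₂ fun u hu => ?_
  by_cases hu1 : -1 < u ∧ u < 1
  swap
  · simp [corrRate, hu1]
  obtain ⟨hu1, hu2⟩ := hu1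
  rw [corrRate_of_mem hu1 hu2]
  refine EReal.le_of_forall_lt_iff_le.1 fun x hx => ?_
  rw [EReal.neg_le, ← EReal.coe_neg]
  apply le_liminf_log_div
  have hx' : corrRateReal ρ u < x := by exact_mod_cast hx
  have h1 := one_sub_sq_pos hρ hρ'
  have h3 := one_sub_mul_pos hρ hρ' hu1.le hu2.le
  set v := (1 - ρ ^ 2) / (1 - ρ * u) with hv
  have hv0 : 0 < v := by positivity
  obtain ⟨ε, hε, hball⟩ := Metric.isOpen_iff.1 isOpen_interior u hu
  have hcont : ContinuousAt (fun t : ℝ × ℝ × ℝ => t.2.1 / √(t.1 * t.2.2)) (v, u * v, v) := by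
    refine ContinuousAt.div (by fun_prop) (by fun_prop) ?_
    exact (Real.sqrt_pos.2 (mul_pos hv0 hv0)).ne'
  obtain ⟨η, hη, hηc⟩ := Metric.continuousAt_iff.1 hcont (ε / 2) (half_pos hε)
  have hval : u * v / √(v * v) = u := by
    rw [Real.sqrt_mul_self hv0.le, mul_div_assoc, div_self hv0.ne', mul_one]
  simp only [hval] at hηc
  have hη' : 0 < min (η / 2) (v / 2) := by positivity
  filter_upwards [H.eventually_le_measure hρ hρ' hu1 hu2 hη' hx',
    hR (v / 2) (by positivity) (ε / 4) (by positivity)] with n hn hRn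
  refine hn.trans (measure_mono_ae ?_)
  filter_upwards [hRn] with ω hω hωD
  obtain ⟨ha, hb, hc⟩ := hωD
  rw [← hv] at ha hb hc
  have m1 : min (η / 2) (v / 2) ≤ η / 2 := min_le_left _ _
  have m2 : min (η / 2) (v / 2) ≤ v / 2 := min_le_right _ _
  have ha2 := (abs_le.1 (ha.trans m2)).1
  have hc2 := (abs_le.1 (hc.trans m2)).1
  have hclose := hω (by linarith) (by linarith)
  have hd : dist (a n ω, b n ω, c n ω) (v, u * v, v) < η := by
    simp only [Prod.dist_eq, Real.dist_eq, max_lt_iff]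
    refine ⟨?_, ?_, ?_⟩ <;> linarith
  have hfar := hηc hd
  rw [Real.dist_eq] at hfar
  apply interior_subset
  apply hball
  rw [Metric.mem_ball, Real.dist_eq]
  calc |R n ω - u| ≤ |R n ω - b n ω / √(a n ω * c n ω)| + |b n ω / √(a n ω * c n ω) - u| :=
        abs_sub_le _ _ _
    _ < ε := by linarith

theorem IsGaussianGram.satisfiesLDP [IsProbabilityMeasure P] (hρ : -1 < ρ) (hρ' : ρ < 1)
    (H : IsGaussianGram P ρ a b c) {R : ℕ → Ω → ℝ} (hR : IsApproxCorr P a b c R) :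
    SatisfiesLDP P R (fun n => (n : ℝ)) (corrRate ρ) where
  speed_tendsto := tendsto_natCast_atTop_atTop
  rate := (isGoodRateFunction_corrRate hρ hρ').toIsRateFunction
  lower A _ := H.le_liminf hρ hρ' hR A
  upper A _ := H.limsup_le hρ hρ' hR A

end GaussianGram

/-! ### Gaussian integrals -/

/-- Completing the square turns the integrand into a constant times the Gaussian density of variance
`v / q` and mean `v β / q`. -/
theorem lintegral_exp_quadratic_gaussianReal {v : NNReal} (hv : v ≠ 0) {β κ : ℝ}
    (h : 0 < 1 - 2 * κ * v) :
    ∫⁻ x, ENNReal.ofReal (Real.exp (β * x + κ * x ^ 2)) ∂(gaussianReal 0 v) =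
      ENNReal.ofReal (Real.exp (v * β ^ 2 / (2 * (1 - 2 * κ * v)) -
        Real.log (1 - 2 * κ * v) / 2)) := by
  set q := 1 - 2 * κ * v with hq
  have hv0 : (0 : ℝ) < v := by exact_mod_cast pos_iff_ne_zero.2 hv
  set w : NNReal := v / q.toNNReal with hw
  have hwq : (w : ℝ) = v / q := by simp [hw, h.le]
  have hw0 : w ≠ 0 := div_ne_zero hv (by simpa using h)
  rw [gaussianReal_of_var_ne_zero 0 hv,
    lintegral_withDensity_eq_lintegral_mul _ (measurable_gaussianPDF 0 v) (by fun_prop)]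
  have key : ∀ x, (gaussianPDF 0 v * fun x => ENNReal.ofReal (Real.exp (β * x + κ * x ^ 2))) x =
      ENNReal.ofReal (Real.exp (v * β ^ 2 / (2 * q) - Real.log q / 2)) *
        gaussianPDF (w * β) w x := by
    intro x
    rw [Pi.mul_apply, gaussianPDF_def, gaussianPDF_def, ← ENNReal.ofReal_mul
      (gaussianPDFReal_nonneg _ _ _), ← ENNReal.ofReal_mul (Real.exp_pos _).le]
    congr 1
    simp only [gaussianPDFReal]
    have hsq : Real.exp (-(Real.log q / 2)) = (√q)⁻¹ := by
      rw [Real.exp_neg, ← Real.log_sqrt h.le, Real.exp_log (Real.sqrt_pos.2 h)]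
    have hsv : √(2 * Real.pi * w) = √(2 * Real.pi * v) * (√q)⁻¹ := by
      rw [hwq, ← Real.sqrt_inv, ← Real.sqrt_mul (by positivity)]
      congr 1
      ring
    have hq0 : √q ≠ 0 := (Real.sqrt_pos.2 h).ne'
    rw [sub_eq_add_neg (v * β ^ 2 / (2 * q)), Real.exp_add (v * β ^ 2 / (2 * q)), hsq, hsv, hwq, mul_inv, inv_inv, mul_assoc, ← Real.exp_add]
    have e : -(x - 0) ^ 2 / (2 * v) + (β * x + κ * x ^ 2) =
        v * β ^ 2 / (2 * q) + -(x - v / q * β) ^ 2 / (2 * (v / q)) := by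
      have : κ = (1 - q) / (2 * v) := by rw [hq]; field_simp; ring
      rw [this]
      field_simp
      ring
    rw [e, Real.exp_add]
    field_simp
  simp_rw [key]
  rw [lintegral_const_mul _ (measurable_gaussianPDF _ _), lintegral_gaussianPDF_eq_one _ hw0,
    mul_one]

theorem lintegral_pi_prod {ι : Type*} [Fintype ι] (μ : Measure ℝ) [IsProbabilityMeasure μ]
    (f : ι → ℝ → ℝ≥0∞) (hf : ∀ i, Measurable (f i)) :
    ∫⁻ x : ι → ℝ, ∏ i, f i (x i) ∂Measure.pi (fun _ => μ) = ∏ i, ∫⁻ t, f i t ∂μ := by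
  rw [lintegral_prod_eq_prod_lintegral_of_indepFun Finset.univ (fun i (x : ι → ℝ) => f i (x i))
    (iIndepFun_pi fun i => (hf i).aemeasurable) fun i => (hf i).comp (measurable_pi_apply i)]
  refine Finset.prod_congr rfl fun i _ => ?_
  exact (measurePreserving_eval (fun _ : ι => μ) i).lintegral_comp (hf i)

/-- The factor `n` cancels the variance `1/n`, so each coordinate pair contributes the same factor.
Integrating out the second variable replaces `α` by its Schur complement `α + β² / (2 q)`. -/
theorem lintegral_exp_quadForm_pi {n : ℕ} (hn : 0 < n) {α β κ : ℝ} (hκ : 0 < 1 - 2 * κ)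
    (hd : 0 < (1 - 2 * α) * (1 - 2 * κ) - β ^ 2) :
    ∫⁻ z : (Fin n → ℝ) × (Fin n → ℝ), ENNReal.ofReal (Real.exp
        (n * ∑ i, (α * z.1 i ^ 2 + β * (z.1 i * z.2 i) + κ * z.2 i ^ 2)))
      ∂((Measure.pi fun _ => gaussianReal 0 (1 / n)).prod
        (Measure.pi fun _ => gaussianReal 0 (1 / n))) =
    ENNReal.ofReal
      (Real.exp (-(n * (Real.log ((1 - 2 * α) * (1 - 2 * κ) - β ^ 2) / 2)))) := by
  have hn' : (0 : ℝ) < n := by exact_mod_cast hn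
  have hv : (1 / n : NNReal) ≠ 0 := by positivity
  have hvr : ((1 / n : NNReal) : ℝ) = 1 / n := by simp
  set q := 1 - 2 * κ with hq
  have hα : 0 < 1 - 2 * (α + β ^ 2 / (2 * q)) := by
    have : 1 - 2 * (α + β ^ 2 / (2 * q)) = ((1 - 2 * α) * q - β ^ 2) / q := by
      field_simp
      ring
    rw [this]
    positivity
  have inner : ∀ t : ℝ, ∫⁻ y, ENNReal.ofReal (Real.exp
      (n * (α * t ^ 2 + β * (t * y) + κ * y ^ 2))) ∂(gaussianReal 0 (1 / n)) =
      ENNReal.ofReal (Real.exp (-(Real.log q / 2))) *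
        ENNReal.ofReal (Real.exp (0 * t + n * (α + β ^ 2 / (2 * q)) * t ^ 2)) := by
    intro t
    have hκn : 1 - 2 * (n * κ) * ((1 / n : NNReal) : ℝ) = q := by
      rw [hvr, hq]
      field_simp
    have h := lintegral_exp_quadratic_gaussianReal hv (β := n * β * t) (κ := n * κ)
      (by rw [hκn]; exact hκ)
    rw [hκn, hvr] at h
    have e : ∀ y : ℝ, ENNReal.ofReal (Real.exp (n * (α * t ^ 2 + β * (t * y) + κ * y ^ 2))) =
        ENNReal.ofReal (Real.exp (n * α * t ^ 2)) *
          ENNReal.ofReal (Real.exp (n * β * t * y + n * κ * y ^ 2)) := by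
      intro y
      rw [← ENNReal.ofReal_mul (Real.exp_pos _).le, ← Real.exp_add]
      congr 2
      ring
    simp_rw [e]
    rw [lintegral_const_mul _ (by fun_prop), h, ← ENNReal.ofReal_mul (Real.exp_pos _).le,
      ← ENNReal.ofReal_mul (Real.exp_pos _).le, ← Real.exp_add, ← Real.exp_add]
    congr 2
    field_simp
    ring
  have outer : ∫⁻ t, ENNReal.ofReal (Real.exp (-(Real.log q / 2))) *
        ENNReal.ofReal (Real.exp (0 * t + n * (α + β ^ 2 / (2 * q)) * t ^ 2))
          ∂(gaussianReal 0 (1 / n)) =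
      ENNReal.ofReal (Real.exp (-(Real.log ((1 - 2 * α) * q - β ^ 2) / 2))) := by
    have hκn : 1 - 2 * (n * (α + β ^ 2 / (2 * q))) * ((1 / n : NNReal) : ℝ) =
        1 - 2 * (α + β ^ 2 / (2 * q)) := by
      rw [hvr]
      field_simp
    rw [lintegral_const_mul _ (by fun_prop),
      lintegral_exp_quadratic_gaussianReal hv (by rw [hκn]; exact hα), hκn,
      ← ENNReal.ofReal_mul (Real.exp_pos _).le, ← Real.exp_add]
    congr 2
    have e : (1 - 2 * α) * q - β ^ 2 = q * (1 - 2 * (α + β ^ 2 / (2 * q))) := by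
      field_simp
      ring
    rw [e, Real.log_mul hκ.ne' hα.ne']
    ring
  have hprod : ∀ z : (Fin n → ℝ) × (Fin n → ℝ), ENNReal.ofReal (Real.exp
        (n * ∑ i, (α * z.1 i ^ 2 + β * (z.1 i * z.2 i) + κ * z.2 i ^ 2))) =
      ∏ i, ENNReal.ofReal (Real.exp
        (n * (α * z.1 i ^ 2 + β * (z.1 i * z.2 i) + κ * z.2 i ^ 2))) := by
    intro z
    rw [Finset.mul_sum, Real.exp_sum, ENNReal.ofReal_prod_of_nonneg fun _ _ => (Real.exp_pos _).le]
  rw [lintegral_prod _ (by fun_prop)]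
  have step : ∀ x : Fin n → ℝ, ∫⁻ y : Fin n → ℝ, ∏ i, ENNReal.ofReal (Real.exp
        (n * (α * x i ^ 2 + β * (x i * y i) + κ * y i ^ 2)))
          ∂(Measure.pi fun _ => gaussianReal 0 (1 / n)) =
      ∏ i, ENNReal.ofReal (Real.exp (-(Real.log q / 2))) *
        ENNReal.ofReal (Real.exp (0 * x i + n * (α + β ^ 2 / (2 * q)) * x i ^ 2)) := by
    intro x
    rw [lintegral_pi_prod (gaussianReal 0 (1 / n)) (fun i y => ENNReal.ofReal (Real.exp
        (n * (α * x i ^ 2 + β * (x i * y) + κ * y ^ 2)))) fun i => by fun_prop]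
    exact Finset.prod_congr rfl fun i _ => inner (x i)
  rw [lintegral_congr fun x => (lintegral_congr fun y => hprod (x, y)).trans (step x),
    lintegral_pi_prod (gaussianReal 0 (1 / n)) (fun _ t => ENNReal.ofReal
    (Real.exp (-(Real.log q / 2))) *
        ENNReal.ofReal (Real.exp (0 * t + n * (α + β ^ 2 / (2 * q)) * t ^ 2)))
    fun i => by fun_prop]
  rw [Finset.prod_const, outer, ← ENNReal.ofReal_pow (Real.exp_pos _).le, ← Real.exp_nat_mul]
  simp

/-! ### Increments of Brownian motion -/

theorem sum_Icc_floor_mul_one (n : ℕ) (f : ℕ → ℝ) :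
    ∑ k ∈ Finset.Icc 1 ⌊(n : ℝ) * 1⌋₊, f k = ∑ i : Fin n, f (i + 1) := by
  rw [mul_one, Nat.floor_natCast, Finset.sum_fin_eq_sum_range, Finset.range_eq_Ico]
  have : Finset.Icc 1 n = Finset.Ico (0 + 1) (n + 1) := by ext; simp
  rw [this, ← Finset.sum_Ico_add' f 0 n 1]
  refine Finset.sum_congr rfl fun i hi => ?_
  rw [dif_pos (Finset.mem_Ico.1 hi).2]

theorem natCast_div_mem_Icc {n k : ℕ} (hk : k ≤ n) : (k : ℝ) / n ∈ Set.Icc (0 : ℝ) 1 :=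
  ⟨by positivity, div_le_one_of_le₀ (by exact_mod_cast hk) (by positivity)⟩

theorem increment_succ {Ω : Type*} (X : ℝ → Ω → ℝ) (n k : ℕ) :
    increment X n (k + 1) = fun ω => X (((k + 1 : ℕ) : ℝ) / n) ω - X ((k : ℝ) / n) ω := by
  funext ω
  simp [increment]

section Brownian

variable {Ω : Type*} [MeasurableSpace Ω] {P : Measure Ω}

theorem IsUnitBrownian.hasLaw_increment {B : ℝ → Ω → ℝ} (hB : IsUnitBrownian P B) {n k : ℕ}
    (hk : k < n) : HasLaw (increment B n (k + 1)) (gaussianReal 0 (1 / n)) P := by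
  have hn : (0 : ℝ) < n := by exact_mod_cast (Nat.zero_le k).trans_lt hk
  have h := hB.law ((k : ℝ) / n) (((k + 1 : ℕ) : ℝ) / n) (natCast_div_mem_Icc hk.le).1
    (by gcongr; simp) (natCast_div_mem_Icc hk).2
  rw [increment_succ]
  convert h using 2
  have : ((k + 1 : ℕ) : ℝ) / n - k / n = 1 / n := by push_cast; ring
  rw [this]
  ext
  simp

theorem IsUnitBrownian.iIndepFun_increment {B : ℝ → Ω → ℝ} (hB : IsUnitBrownian P B) (n : ℕ) :
    iIndepFun (fun (i : Fin n) => increment B n (i + 1)) P := by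
  have h := hB.indep n (fun i => ⟨((i : ℕ) : ℝ) / n, natCast_div_mem_Icc (by omega)⟩)
    fun i j hij => by
      simp only [Subtype.mk_le_mk]
      gcongr
      exact_mod_cast hij
  convert h using 2 with i
  rw [increment_succ]
  simp

theorem IsUnitBrownian.map_increments [IsProbabilityMeasure P] {B : ℝ → Ω → ℝ}
    (hB : IsUnitBrownian P B) (n : ℕ) :
    P.map (fun ω (i : Fin n) => increment B n (i + 1) ω) =
      Measure.pi (fun _ => gaussianReal 0 (1 / n)) := by
  rw [(iIndepFun_iff_map_fun_eq_pi_map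
    fun i : Fin n => (hB.hasLaw_increment i.2).aemeasurable).1 (hB.iIndepFun_increment n)]
  congr 1
  funext i
  exact (hB.hasLaw_increment i.2).map_eq

theorem IndepUnitProcesses.indepFun_increments {B B' : ℝ → Ω → ℝ}
    (h : IndepUnitProcesses P B B') (n : ℕ) :
    IndepFun (fun ω (i : Fin n) => increment B n (i + 1) ω)
      (fun ω (i : Fin n) => increment B' n (i + 1) ω) P := by
  let φ : (Set.Icc (0 : ℝ) 1 → ℝ) → Fin n → ℝ := fun f i =>
    f ⟨(((i : ℕ) + 1 : ℕ) : ℝ) / n, natCast_div_mem_Icc (by omega)⟩ -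
      f ⟨((i : ℕ) : ℝ) / n, natCast_div_mem_Icc (by omega)⟩
  have hφ : Measurable φ := by fun_prop
  convert IndepFun.comp h hφ hφ using 1 <;>
    · funext ω i
      rw [increment_succ]
      rfl

theorem isGaussianGram_brownian [IsProbabilityMeasure P] {ρ : ℝ} (hρ : -1 < ρ) (hρ' : ρ < 1)
    {B B' : ℝ → Ω → ℝ} (hB : IsUnitBrownian P B) (hB' : IsUnitBrownian P B')
    (hind : IndepUnitProcesses P B B') :
    IsGaussianGram P ρ (realizedVol B 1)
      (realizedCov B (fun t ω => ρ * B t ω + √(1 - ρ ^ 2) * B' t ω) 1)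
      (realizedVol (fun t ω => ρ * B t ω + √(1 - ρ ^ 2) * B' t ω) 1) := by
  set s := √(1 - ρ ^ 2) with hs
  have hs2 : s ^ 2 = 1 - ρ ^ 2 := Real.sq_sqrt (one_sub_sq_pos hρ hρ').le
  have hinc : ∀ n k ω, increment (fun t ω => ρ * B t ω + s * B' t ω) n k ω =
      ρ * increment B n k ω + s * increment B' n k ω := by
    intro n k ω
    simp only [increment]
    ring
  have hm : ∀ n (i : Fin n), AEMeasurable (increment B n (i + 1)) P := fun n i =>
    (hB.hasLaw_increment i.2).aemeasurable
  have hm' : ∀ n (i : Fin n), AEMeasurable (increment B' n (i + 1)) P := fun n i =>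
    (hB'.hasLaw_increment i.2).aemeasurable
  have ea : ∀ n, realizedVol B 1 n = fun ω => ∑ i : Fin n, increment B n (i + 1) ω ^ 2 :=
    fun n => funext fun ω => sum_Icc_floor_mul_one n _
  have eb : ∀ n, realizedCov B (fun t ω => ρ * B t ω + s * B' t ω) 1 n = fun ω =>
      ∑ i : Fin n, increment B n (i + 1) ω *
        (ρ * increment B n (i + 1) ω + s * increment B' n (i + 1) ω) := fun n => funext fun ω => by
    simp only [realizedCov, hinc]
    exact sum_Icc_floor_mul_one n fun k => increment B n k ω *
        (ρ * increment B n k ω + s * increment B' n k ω)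
  have ec : ∀ n, realizedVol (fun t ω => ρ * B t ω + s * B' t ω) 1 n = fun ω =>
      ∑ i : Fin n, (ρ * increment B n (i + 1) ω + s * increment B' n (i + 1) ω) ^ 2 :=
    fun n => funext fun ω => by
      simp only [realizedVol, hinc]
      exact sum_Icc_floor_mul_one n fun k => (ρ * increment B n k ω + s * increment B' n k ω) ^ 2
  refine ⟨fun n _ => ?_, fun n _ => ?_, fun n _ => ?_, fun n hn α β κ hd => ?_⟩
  · rw [ea]
    exact Finset.aemeasurable_fun_sum _ fun i _ => (hm n i).pow_const 2
  · rw [eb]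
    exact Finset.aemeasurable_fun_sum _ fun i _ =>
      (hm n i).mul (((hm n i).const_mul ρ).add ((hm' n i).const_mul s))
  · rw [ec]
    exact Finset.aemeasurable_fun_sum _ fun i _ =>
      (((hm n i).const_mul ρ).add ((hm' n i).const_mul s)).pow_const 2
  -- These are the coefficients of the quadratic form after substituting `y = ρ x + s z` with `x`,
  -- `z` independent.
  · have hdet : (1 - 2 * (α + β * ρ + κ * ρ ^ 2)) * (1 - 2 * (κ * s ^ 2)) -
        (s * (β + 2 * κ * ρ)) ^ 2 = quadDet ρ α β κ := by
      rw [mul_pow, hs2, quadDet]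
      ring
    have h := lintegral_exp_quadForm_pi hn (α := α + β * ρ + κ * ρ ^ 2)
      (β := s * (β + 2 * κ * ρ)) (κ := κ * s ^ 2) (by rw [hs2]; linarith [hd.1])
      (by rw [hdet]; exact hd.2)
    have hU : AEMeasurable (fun ω (i : Fin n) => increment B n (i + 1) ω) P :=
      aemeasurable_pi_lambda _ (hm n)
    have hW : AEMeasurable (fun ω (i : Fin n) => increment B' n (i + 1) ω) P :=
      aemeasurable_pi_lambda _ (hm' n)
    have hmap := (indepFun_iff_map_prod_eq_prod_map_map hU hW).1 (hind.indepFun_increments n)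
    rw [hB.map_increments, hB'.map_increments] at hmap
    rw [hdet, ← hmap, lintegral_map' (by fun_prop) (hU.prodMk hW)] at h
    rw [← h, ea, eb, ec]
    refine lintegral_congr fun ω => ?_
    congr 3
    simp only [Finset.mul_sum, ← Finset.sum_add_distrib]
    refine Finset.sum_congr rfl fun i _ => ?_
    ring

end Brownian

/-! ### Perturbation of correlations -/

section Perturbation

variable {E : Type*} [NormedAddCommGroup E] [InnerProductSpace ℝ E]

/-- Multiplied by `‖g‖`, the difference equals `(‖g‖ - ‖x‖) x/‖x‖ + (x - g)`. The case `x = 0` is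
covered by `0⁻¹ = 0`, which matches the value `0` of a degenerate realized correlation. -/
theorem norm_inv_smul_sub_le (x : E) {g : E} (hg : g ≠ 0) :
    ‖‖x‖⁻¹ • x - ‖g‖⁻¹ • g‖ ≤ 2 * (‖x - g‖ / ‖g‖) := by
  have hg0 : 0 < ‖g‖ := norm_pos_iff.2 hg
  have hx : ‖x‖ • ‖x‖⁻¹ • x = x := by
    rcases eq_or_ne x 0 with rfl | h
    · simp
    · rw [smul_smul, mul_inv_cancel₀ (norm_ne_zero_iff.2 h), one_smul]
  have hx1 : ‖‖x‖⁻¹ • x‖ ≤ 1 := by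
    rw [norm_smul, norm_inv, norm_norm]
    exact inv_mul_le_one
  have e : ‖g‖ • (‖x‖⁻¹ • x - ‖g‖⁻¹ • g) = (‖g‖ - ‖x‖) • ‖x‖⁻¹ • x + (x - g) := by
    rw [smul_sub, sub_smul, hx, smul_smul ‖g‖ ‖g‖⁻¹, mul_inv_cancel₀ hg0.ne', one_smul]
    abel
  have h : ‖g‖ * ‖‖x‖⁻¹ • x - ‖g‖⁻¹ • g‖ ≤ 2 * ‖x - g‖ := by
    rw [← norm_norm g, ← norm_smul, norm_norm, e]
    refine (norm_add_le _ _).trans ?_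
    rw [norm_smul, Real.norm_eq_abs]
    have h1 : |‖g‖ - ‖x‖| ≤ ‖x - g‖ := by
      rw [norm_sub_rev]
      exact abs_norm_sub_norm_le g x
    nlinarith [norm_nonneg (‖x‖⁻¹ • x), norm_nonneg (x - g)]
  rw [← mul_div_assoc, le_div_iff₀ hg0]
  linarith

theorem abs_inner_div_sub_le (x y : E) {g h : E} (hg : g ≠ 0) (hh : h ≠ 0) :
    |inner ℝ x y / (‖x‖ * ‖y‖) - inner ℝ g h / (‖g‖ * ‖h‖)| ≤
      2 * (‖x - g‖ / ‖g‖) + 2 * (‖y - h‖ / ‖h‖) := by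
  have key : ∀ p q : E, inner ℝ p q / (‖p‖ * ‖q‖) = inner ℝ (‖p‖⁻¹ • p) (‖q‖⁻¹ • q) := by
    intro p q
    rw [real_inner_smul_left, real_inner_smul_right, div_eq_mul_inv, mul_inv]
    ring
  have hle : ∀ p : E, ‖‖p‖⁻¹ • p‖ ≤ 1 := by
    intro p
    rw [norm_smul, norm_inv, norm_norm]
    exact inv_mul_le_one
  rw [key, key]
  have e : inner ℝ (‖x‖⁻¹ • x) (‖y‖⁻¹ • y) - inner ℝ (‖g‖⁻¹ • g) (‖h‖⁻¹ • h) =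
      inner ℝ (‖x‖⁻¹ • x - ‖g‖⁻¹ • g) (‖y‖⁻¹ • y) +
        inner ℝ (‖g‖⁻¹ • g) (‖y‖⁻¹ • y - ‖h‖⁻¹ • h) := by
    rw [inner_sub_left, inner_sub_right]
    ring
  rw [e]
  refine (abs_add_le _ _).trans (add_le_add ?_ ?_)
  · calc _ ≤ ‖‖x‖⁻¹ • x - ‖g‖⁻¹ • g‖ * ‖‖y‖⁻¹ • y‖ := abs_real_inner_le_norm _ _
      _ ≤ ‖‖x‖⁻¹ • x - ‖g‖⁻¹ • g‖ * 1 := by gcongr; exact hle y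
      _ ≤ _ := by rw [mul_one]; exact norm_inv_smul_sub_le x hg
  · calc _ ≤ ‖‖g‖⁻¹ • g‖ * ‖‖y‖⁻¹ • y - ‖h‖⁻¹ • h‖ := abs_real_inner_le_norm _ _
      _ ≤ 1 * ‖‖y‖⁻¹ • y - ‖h‖⁻¹ • h‖ := by gcongr; exact hle g
      _ ≤ _ := by rw [one_mul]; exact norm_inv_smul_sub_le y hh

end Perturbation

/-! ### Drift -/

section Drift

variable {Ω : Type*}

/-- The increments up to time `t` as a vector. -/
noncomputable def incrementVec (X : ℝ → Ω → ℝ) (t : ℝ) (n : ℕ) (ω : Ω) :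
    EuclideanSpace ℝ (Finset.Icc 1 ⌊(n : ℝ) * t⌋₊) :=
  WithLp.toLp 2 fun k => increment X n k ω

theorem inner_incrementVec (X Y : ℝ → Ω → ℝ) (t : ℝ) (n : ℕ) (ω : Ω) :
    inner ℝ (incrementVec X t n ω) (incrementVec Y t n ω) = realizedCov X Y t n ω := by
  rw [PiLp.inner_apply, realizedCov,
    ← Finset.sum_coe_sort _ fun k => increment X n k ω * increment Y n k ω]
  refine Finset.sum_congr rfl fun k _ => ?_
  simp [incrementVec, mul_comm]

theorem norm_sq_incrementVec (X : ℝ → Ω → ℝ) (t : ℝ) (n : ℕ) (ω : Ω) :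
    ‖incrementVec X t n ω‖ ^ 2 = realizedVol X t n ω := by
  rw [← real_inner_self_eq_norm_sq, inner_incrementVec]
  simp only [realizedCov, realizedVol, sq]

theorem realizedCorr_eq (X Y : ℝ → Ω → ℝ) (t : ℝ) (n : ℕ) (ω : Ω) :
    realizedCorr X Y t n ω = inner ℝ (incrementVec X t n ω) (incrementVec Y t n ω) /
      (‖incrementVec X t n ω‖ * ‖incrementVec Y t n ω‖) := by
  rw [realizedCorr, ← norm_sq_incrementVec, ← norm_sq_incrementVec, ← mul_pow,
    Real.sqrt_sq (by positivity), inner_incrementVec]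

/-- There are `n` coordinates of size at most `C / n`, hence a squared norm of at most `C² / n`. -/
theorem norm_incrementVec_sub_le {X B : ℝ → Ω → ℝ} {σ C : ℝ} {n : ℕ} {ω : Ω}
    (hC : 0 ≤ C)
    (h : ∀ k ∈ Finset.Icc 1 n, |increment X n k ω - σ * increment B n k ω| ≤ C / n) :
    ‖incrementVec X 1 n ω - σ • incrementVec B 1 n ω‖ ≤ C / √n := by
  rcases Nat.eq_zero_or_pos n with rfl | hn
  · have : IsEmpty (Finset.Icc 1 ⌊((0 : ℕ) : ℝ) * 1⌋₊) := by
      simp only [CharP.cast_eq_zero, zero_mul, Nat.floor_zero]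
      exact Finset.isEmpty_coe_sort.2 rfl
    rw [Subsingleton.elim (incrementVec X 1 0 ω - σ • incrementVec B 1 0 ω) 0]
    simp
  have hn' : (0 : ℝ) < n := by exact_mod_cast hn
  rw [EuclideanSpace.norm_eq]
  apply Real.sqrt_le_iff.2 ⟨by positivity, ?_⟩
  calc _ ≤ ∑ _k : Finset.Icc 1 ⌊(n : ℝ) * 1⌋₊, (C / n) ^ 2 := by
        refine Finset.sum_le_sum fun k _ => ?_
        have hk : (k : ℕ) ∈ Finset.Icc 1 n := by
          have hS : Finset.Icc 1 n = Finset.Icc 1 ⌊(n : ℝ) * 1⌋₊ := by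
            rw [mul_one, Nat.floor_natCast]
          rw [hS]
          exact k.2
        have := h k hk
        simp only [incrementVec, PiLp.sub_apply, PiLp.smul_apply, smul_eq_mul, Real.norm_eq_abs]
        gcongr
    _ = (C / √n) ^ 2 := by
        rw [Finset.sum_const, Finset.card_univ, Fintype.card_coe, Nat.card_Icc, mul_one,
          Nat.floor_natCast, nsmul_eq_mul, div_pow, div_pow, Real.sq_sqrt hn'.le,
          Nat.add_sub_cancel]
        field_simp

theorem abs_realizedCorr_sub_le {X Y B B' : ℝ → Ω → ℝ} {σ σ' C C' δ : ℝ} (hσ : 0 < σ)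
    (hσ' : 0 < σ') (hC : 0 ≤ C) (hC' : 0 ≤ C') (hδ : 0 < δ) {n : ℕ} {ω : Ω}
    (h : ∀ k ∈ Finset.Icc 1 n, |increment X n k ω - σ * increment B n k ω| ≤ C / n)
    (h' : ∀ k ∈ Finset.Icc 1 n, |increment Y n k ω - σ' * increment B' n k ω| ≤ C' / n)
    (hB : δ ≤ realizedVol B 1 n ω) (hB' : δ ≤ realizedVol B' 1 n ω) :
    |realizedCorr X Y 1 n ω - realizedCorr B B' 1 n ω| ≤
      (2 * (C / (σ * √δ)) + 2 * (C' / (σ' * √δ))) / √n := by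
  have hsδ : 0 < √δ := Real.sqrt_pos.2 hδ
  have hg : √δ ≤ ‖incrementVec B 1 n ω‖ :=
    Real.sqrt_le_iff.2 ⟨norm_nonneg _, by rwa [norm_sq_incrementVec]⟩
  have hg' : √δ ≤ ‖incrementVec B' 1 n ω‖ :=
    Real.sqrt_le_iff.2 ⟨norm_nonneg _, by rwa [norm_sq_incrementVec]⟩
  have hg0 : incrementVec B 1 n ω ≠ 0 := norm_pos_iff.1 (hsδ.trans_le hg)
  have hg0' : incrementVec B' 1 n ω ≠ 0 := norm_pos_iff.1 (hsδ.trans_le hg')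
  have hscale : realizedCorr B B' 1 n ω =
      inner ℝ (σ • incrementVec B 1 n ω) (σ' • incrementVec B' 1 n ω) /
        (‖σ • incrementVec B 1 n ω‖ * ‖σ' • incrementVec B' 1 n ω‖) := by
    rw [realizedCorr_eq, real_inner_smul_left, real_inner_smul_right, norm_smul, norm_smul,
      Real.norm_of_nonneg hσ.le, Real.norm_of_nonneg hσ'.le]
    have := norm_ne_zero_iff.2 hg0
    have := norm_ne_zero_iff.2 hg0'
    field_simp
  rw [hscale, realizedCorr_eq]
  refine (abs_inner_div_sub_le _ _ (smul_ne_zero hσ.ne' hg0) (smul_ne_zero hσ'.ne' hg0')).trans ?_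
  have hn1 := norm_incrementVec_sub_le hC h
  have hn2 := norm_incrementVec_sub_le hC' h'
  calc _ ≤ 2 * (C / √n / (σ * √δ)) + 2 * (C' / √n / (σ' * √δ)) := by
        rw [norm_smul, norm_smul, Real.norm_of_nonneg hσ.le, Real.norm_of_nonneg hσ'.le]
        gcongr
    _ = _ := by ring

variable [MeasurableSpace Ω] {P : Measure Ω}

theorem BoundedDrift.exists_bound [IsProbabilityMeasure P] {b : ℝ → Ω → ℝ}
    (hb : BoundedDrift P b) :
    ∃ C, 0 ≤ C ∧ ∀ᵐ ω ∂P, ∀ s t : ℝ, 0 ≤ s → s ≤ t → t ≤ 1 →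
      |(∫ r in (0 : ℝ)..t, b r ω) - ∫ r in (0 : ℝ)..s, b r ω| ≤ C * (t - s) := by
  -- Swapping the factors lets Fubini give, for almost every `ω`, a bound at almost every time; a
  -- single null set then serves all `s` and `t`.
  have hb' : MemLp (fun p : Ω × ℝ => b p.2 p.1) ∞
      (P.prod (volume.restrict (Set.Icc (0 : ℝ) 1))) :=
    hb.comp_measurePreserving Measure.measurePreserving_swap
  have hint : Integrable (fun p : Ω × ℝ => b p.2 p.1)
      (P.prod (volume.restrict (Set.Icc (0 : ℝ) 1))) := hb'.integrable le_top
  set C := (eLpNormEssSup (fun p : Ω × ℝ => b p.2 p.1)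
    (P.prod (volume.restrict (Set.Icc (0 : ℝ) 1)))).toReal with hC
  have hbound : ∀ᵐ p ∂(P.prod (volume.restrict (Set.Icc (0 : ℝ) 1))), |b p.2 p.1| ≤ C := by
    have hlt := hb'.eLpNorm_lt_top
    rw [eLpNorm_exponent_top] at hlt
    filter_upwards [ae_le_eLpNormEssSup (f := fun p : Ω × ℝ => b p.2 p.1)] with p hp
    have := ENNReal.toReal_mono hlt.ne hp
    simpa using this
  refine ⟨C, ENNReal.toReal_nonneg, ?_⟩
  filter_upwards [Measure.ae_ae_of_ae_prod hbound, hint.prod_right_ae] with ω hω hωi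
  intro s t hs hst ht
  have hii : ∀ u v : ℝ, u ∈ Set.Icc (0 : ℝ) 1 → v ∈ Set.Icc (0 : ℝ) 1 →
      IntervalIntegrable (fun r => b r ω) volume u v := by
    intro u v hu hv
    refine (intervalIntegrable_iff.2 (IntegrableOn.mono_set hωi ?_))
    exact Set.uIoc_subset_uIcc.trans (Set.uIcc_subset_Icc hu hv)
  have h0 : (0 : ℝ) ∈ Set.Icc (0 : ℝ) 1 := by simp
  have hs' : s ∈ Set.Icc (0 : ℝ) 1 := ⟨hs, hst.trans ht⟩
  have ht' : t ∈ Set.Icc (0 : ℝ) 1 := ⟨hs.trans hst, ht⟩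
  rw [intervalIntegral.integral_interval_sub_left (hii 0 t h0 ht') (hii 0 s h0 hs')]
  have h := intervalIntegral.norm_integral_le_of_norm_le_const_ae (a := s) (b := t) (C := C)
    (f := fun r => b r ω) (by
      filter_upwards [(ae_restrict_iff' measurableSet_Icc).1 hω] with r hr hrst
      exact hr (Set.uIcc_subset_Icc hs' ht' (Set.uIoc_subset_uIcc hrst)))
  rwa [abs_of_nonneg (sub_nonneg.2 hst)] at h

theorem IsItoProcess.congr {σ : ℝ} {B B' b X : ℝ → Ω → ℝ} (hX : IsItoProcess P σ B b X)
    (h : ∀ t : ℝ, 0 ≤ t → t ≤ 1 → ∀ᵐ ω ∂P, B t ω = B' t ω) : IsItoProcess P σ B' b X := by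
  intro t ht ht'
  filter_upwards [hX t ht ht', h t ht ht', h 0 le_rfl zero_le_one] with ω h1 h2 h3
  rw [h1, h2, h3]

/-- The integral equation holds almost surely at each fixed time, which is enough since each `n`
involves finitely many grid points; `C` does not depend on `n`. -/
theorem IsItoProcess.exists_increment_bound [IsProbabilityMeasure P] {σ : ℝ}
    {B b X : ℝ → Ω → ℝ} (hb : BoundedDrift P b) (hX : IsItoProcess P σ B b X) :
    ∃ C, 0 ≤ C ∧ ∀ n : ℕ, ∀ᵐ ω ∂P, ∀ k ∈ Finset.Icc 1 n,
      |increment X n k ω - σ * increment B n k ω| ≤ C / n := by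
  obtain ⟨C, hC, hbd⟩ := hb.exists_bound
  refine ⟨C, hC, fun n => ?_⟩
  rw [Filter.eventually_all_finset]
  intro k hk
  obtain ⟨hk1, hkn⟩ := Finset.mem_Icc.1 hk
  obtain ⟨j, rfl⟩ := Nat.exists_eq_add_of_le' hk1
  have hj := natCast_div_mem_Icc (Nat.le_of_succ_le hkn)
  have hj' := natCast_div_mem_Icc hkn
  have hle : (j : ℝ) / n ≤ ((j + 1 : ℕ) : ℝ) / n := by
    gcongr
    simp
  filter_upwards [hbd, hX _ hj.1 hj.2, hX _ hj'.1 hj'.2] with ω h1 h2 h3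
  rw [increment_succ, increment_succ]
  dsimp only
  rw [h2, h3]
  have h4 := h1 _ _ hj.1 hle hj'.2
  have e : C * (((j + 1 : ℕ) : ℝ) / n - j / n) = C / n := by
    push_cast
    ring
  rw [e] at h4
  convert h4 using 2
  ring

theorem isApproxCorr_realizedCorr [IsProbabilityMeasure P] {σ₁ σ₂ : ℝ} (hσ₁ : 0 < σ₁)
    (hσ₂ : 0 < σ₂) {B₁ B₂ b₁ b₂ X₁ X₂ : ℝ → Ω → ℝ} (hb₁ : BoundedDrift P b₁)
    (hb₂ : BoundedDrift P b₂) (hX₁ : IsItoProcess P σ₁ B₁ b₁ X₁)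
    (hX₂ : IsItoProcess P σ₂ B₂ b₂ X₂) :
    IsApproxCorr P (realizedVol B₁ 1) (realizedCov B₁ B₂ 1) (realizedVol B₂ 1)
      (realizedCorr X₁ X₂ 1) := by
  obtain ⟨C₁, hC₁, h₁⟩ := hX₁.exists_increment_bound hb₁
  obtain ⟨C₂, hC₂, h₂⟩ := hX₂.exists_increment_bound hb₂
  intro δ hδ ε hε
  have hlim : Tendsto (fun n : ℕ =>
      (2 * (C₁ / (σ₁ * √δ)) + 2 * (C₂ / (σ₂ * √δ))) / √(n : ℝ)) atTop (𝓝 0) :=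
    Tendsto.const_div_atTop (Real.tendsto_sqrt_atTop.comp tendsto_natCast_atTop_atTop) _
  filter_upwards [hlim.eventually (eventually_le_nhds hε)] with n hn
  filter_upwards [h₁ n, h₂ n] with ω hω₁ hω₂ ha hc
  exact (abs_realizedCorr_sub_le hσ₁ hσ₂ hC₁ hC₂ hδ hω₁ hω₂ ha hc).trans hn

end Drift

theorem mainTheorem8 {Ω : Type*} [MeasurableSpace Ω] (P : Measure Ω) [IsProbabilityMeasure P]
    (σ₁ σ₂ ρ : ℝ) (hσ₁ : 0 < σ₁) (hσ₂ : 0 < σ₂) (hρ : -1 < ρ) (hρ' : ρ < 1)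
    (B₁ B₂ B₃ : ℝ → Ω → ℝ)
    (hB₁ : IsUnitBrownian P B₁) (hB₃ : IsUnitBrownian P B₃) (hind : IndepUnitProcesses P B₁ B₃)
    (hB₂ : ∀ t : ℝ, 0 ≤ t → t ≤ 1 →
      ∀ᵐ ω ∂P, B₂ t ω = ρ * B₁ t ω + √(1 - ρ ^ 2) * B₃ t ω)
    (b₁ b₂ : ℝ → Ω → ℝ) (hb₁ : BoundedDrift P b₁) (hb₂ : BoundedDrift P b₂)
    (X₁ X₂ : ℝ → Ω → ℝ)
    (hX₁ : IsItoProcess P σ₁ B₁ b₁ X₁) (hX₂ : IsItoProcess P σ₂ B₂ b₂ X₂) :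
    IsGoodRateFunction (corrRate ρ) ∧
      SatisfiesLDP P (fun n => realizedCorr X₁ X₂ 1 n) (fun n => (n : ℝ)) (corrRate ρ) :=
  ⟨isGoodRateFunction_corrRate hρ hρ',
    (isGaussianGram_brownian hρ hρ' hB₁ hB₃ hind).satisfiesLDP hρ hρ'
      (isApproxCorr_realizedCorr hσ₁ hσ₂ hb₁ hb₂ hX₁ (hX₂.congr hB₂))⟩
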